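/- Let $k_1\ge k_2>0$ and $k_3=-k_1k_2/(k_1+k_2)$ (parabolic case), and consider motions $t\mapsto(z_1,z_2,z_3)(t)\in\mathbb C^3$, $t\in\mathbb R$, of three distinct point vortices, $\dot z_j=-i\sum_{m\ne j}k_m/(\bar z_m-\bar z_j)$. Let $R_j$ be the side of the vortex triangle facing $z_j$, $p=R_1+R_2+R_3$, and $x_j=R_j/p$ the trilinear coordinates; let $\gamma\in\{1,0,-1\}$ be the orientation ($1$ if $z_1,z_2,z_3$ is counterclockwise, $-1$ if clockwise, $0$ if collinear). The pair $(x,\gamma)$ is regarded as a point on the positive ($\gamma=1$) or negative ($\gamma=-1$) side of the triangle $\triangle_Q=\{x: x_1+x_2+x_3=1,\ 0\le x_j\le\frac12\}$; an edge $x_j=\frac12$ is where the sides meet, and $(x,1),(x,-1)$ are images of each other. Put $$\bar I(x)=\Big(\frac{x_1}{x_3}\Big)^{k_2}\Big(\frac{x_2}{x_3}\Big)^{k_1},\qquad \mathcal Y(x)=k_2k_3x_1^2+k_3k_1x_2^2+k_1k_2x_3^2 .$$ The critical curve $\mathcal C$ is $\{x\in\triangle_Q:\mathcal Y(x)=0\}$;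 a point is above (below) $\mathcal C$ if $\mathcal Y>0$ ($\mathcal Y<0$). With $q=\sqrt{k_1^2+k_1k_2+k_2^2}$ let $E=(\frac13,\frac13,\frac13)$, $Q_4=(\frac12,\frac12-\beta_4,\beta_4)$, $\beta_4=\frac{q-k_1}{2k_2}$, and $Q_5=(\frac12-\beta_5,\frac12,\beta_5)$, $\beta_5=\frac{q-k_2}{2k_1}$; put $\bar I_4=\bar I(Q_4)$, $\bar I_5=\bar I(Q_5)$. Arcs $AB$ of $\mathcal C$ are open, ordered by $\alpha=(x_2-x_1)/\sqrt3$; a star denotes the image on the negative side. A point $(x,\gamma)$ is called contracting (expanding) if it is the shape of some configuration of three distinct vortices and if, for all configurations with this shape, $\dot x=0$ and $\dot p<0$ ($\dot p>0$). A trajectory departs from (ends at) $(q,\gamma)$ if $x(t)\to q$ as $t\to-\infty$ ($t\to+\infty$) and its orientation is eventually $\gamma$ in that limit. There is exactly one point $S_4\in\mathcal C$ with $x_1<x_2$ and $\bar I(S_4)=\bar I_4$. Every configuration of distinct vortices with $\bar I(x)\in(\bar I_5,1)$ and $\mathcal Y(x)\neq0$ is the value at $t=0$ of a motion defined for all $t\in\mathbb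 R$. For every motion defined for all $t\in\mathbb R$ the following holds. * **Type I.** (a) If at $t=0$ one has $\gamma=1$, $\mathcal Y<0$, $x_1<x_2$ and $\bar I\in(\bar I_5,1)$, then $\bar I$ is constant in $t$, $\mathcal Y<0$ and $x_1<x_2$ for all $t$, the trajectory departs from a point of the arc $EQ_5$ on the positive side, which is contracting, crosses exactly once from the positive to the negative side, through the edge $Q_3Q_1$ ($x_2=\frac12$), and ends at the image of its departure point, which lies on $E^*Q_5$ and is expanding. (b) If at $t=0$ one has $\gamma=-1$, $\mathcal Y<0$, $x_2<x_1$ and $\bar I\in(\bar I_4,1)$, then $\bar I$ is constant, $\mathcal Y<0$ and $x_2<x_1$ for all $t$, the trajectory departs from a contracting point of $E^*Q_4$ on the negative side, crosses exactly once, through the edge $Q_2Q_3$ ($x_1=\frac12$), and ends at the image of its departure point, which lies on $Q_4E$ on the positive side and is expanding. * **Type II.** If at $t=0$ one has $\gamma=1$, $\mathcal Y>0$ and $\bar I\in(\bar I_4,1)$, then $\bar I$ is constant, $\mathcal Y>0$ and $\gamma=1$ for all $t$, the trajectory departs from a contracting point of $ES_4$ and ends at an expanding point of $Q_4E$. If instead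 $\gamma=-1$ at $t=0$, then likewise $\bar I$ is constant, $\mathcal Y>0$ and $\gamma=-1$ for all $t$, and it departs from a contracting point of $E^*Q_4$ and ends at an expanding point of $E^*S_4^*$, the image of $ES_4$. * **Type III.** If at $t=0$ one has $\gamma=1$, $\mathcal Y>0$ and $\bar I\in(\bar I_5,\bar I_4)$, then $\bar I$ is constant, $\mathcal Y>0$ for all $t$, the trajectory departs from a contracting point of $S_4Q_5$ on the positive side, crosses exactly once to the negative side, through the edge $Q_2Q_3$ ($x_1=\frac12$), and ends at the image of its departure point, which lies on $E^*Q_5$ and is expanding. Conversely, every such motion that departs from a contracting point and has $\mathcal Y\ne0$ at $t=0$ is of type I, II or III, unless it lies above $\mathcal C$ on the separatrix $\bar I=\bar I_4$. -/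

import Mathlib

open Filter Topology Set

noncomputable section

namespace ThreeVortex

/-! Configurations of three point vortices. The vortices `1, 2, 3` carry the indices `0, 1, 2`. -/

/-- The positions of the three vortices in the complex plane. -/
abbrev Config : Type := Fin 3 → ℂ

/-- The strengths `k₁`, `k₂`, `k₃ = -k₁ k₂ / (k₁ + k₂)` in the parabolic case
`k₁ k₂ + k₂ k₃ + k₃ k₁ = 0`. -/
def strength (k₁ k₂ : ℝ) : Fin 3 → ℝ := ![k₁, k₂, -(k₁ * k₂) / (k₁ + k₂)]

/-- The velocity of the `j`-th vortex. -/
def velocity (k : Fin 3 → ℝ) (c : Config) (j : Fin 3) : ℂ :=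
  -Complex.I * ∑ m ∈ Finset.univ.erase j,
    (k m : ℂ) / ((starRingEnd ℂ) (c m) - (starRingEnd ℂ) (c j))

/-- The curve `z` satisfies the equations of motion at time `t`, the vortices being distinct. -/
def SolvesAt (k : Fin 3 → ℝ) (z : ℝ → Config) (t : ℝ) : Prop :=
  Function.Injective (z t) ∧ ∀ j, HasDerivAt (fun s => z s j) (velocity k (z t) j) t

/-- A motion of three distinct point vortices, defined for all times. -/
def IsMotion (k : Fin 3 → ℝ) (z : ℝ → Config) : Prop := ∀ t, SolvesAt k z t

/-- The length of the side of the triangle facing the `j`-th vortex. -/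
def side (c : Config) (j : Fin 3) : ℝ := ‖c (j + 1) - c (j + 2)‖

/-- The perimeter of the triangle. -/
def perimeter (c : Config) : ℝ := ∑ j, side c j

/-- The trilinear coordinates: the sides of the similar triangle of unit perimeter. -/
def tri (c : Config) (j : Fin 3) : ℝ := side c j / perimeter c

/-- The signed area, positive when the vortices `1, 2, 3` are in counterclockwise order. -/
def signedArea (c : Config) : ℝ := ((starRingEnd ℂ) (c 1 - c 0) * (c 2 - c 0)).im / 2

/-- The orientation: `1` counterclockwise, `-1` clockwise, `0` collinear. It tells the side of the
plane of trilinear coordinates on which the point `tri c` lies. -/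
def orientation (c : Config) : SignType := SignType.sign (signedArea c)

/-! The plane of trilinear coordinates. -/

/-- The integral invariant of the planar trajectories. -/
def invI (k : Fin 3 → ℝ) (x : Fin 3 → ℝ) : ℝ := (x 0 / x 2) ^ k 1 * (x 1 / x 2) ^ k 0

/-- The quadratic form that vanishes on the critical curve, is positive above and negative
below it. -/
def formY (k : Fin 3 → ℝ) (x : Fin 3 → ℝ) : ℝ :=
  k 1 * k 2 * x 0 ^ 2 + k 2 * k 0 * x 1 ^ 2 + k 0 * k 1 * x 2 ^ 2

/-- The closed triangle `Q₁Q₂Q₃` of admissible trilinear coordinates. -/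
def triangleQ : Set (Fin 3 → ℝ) := {x | ∑ j, x j = 1 ∧ ∀ j, 0 ≤ x j ∧ x j ≤ 1 / 2}

/-- The critical curve (the same points on either side of the plane). -/
def criticalCurve (k : Fin 3 → ℝ) : Set (Fin 3 → ℝ) := {x | x ∈ triangleQ ∧ formY k x = 0}

/-- The Cartesian abscissa in the plane of trilinear coordinates; the critical curve is a graph
over it. -/
def abscissa (x : Fin 3 → ℝ) : ℝ := (x 1 - x 0) / √3

/-- The centroid. -/
def pointE : Fin 3 → ℝ := fun _ => 1 / 3

/-- The end point of the critical curve on the edge `Q₂Q₃`, where `x₁ = 1/2`. -/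
def pointQ4 (k : Fin 3 → ℝ) : Fin 3 → ℝ :=
  let β := (√(k 0 ^ 2 + k 0 * k 1 + k 1 ^ 2) - k 0) / (2 * k 1)
  ![1 / 2, 1 / 2 - β, β]

/-- The end point of the critical curve on the edge `Q₃Q₁`, where `x₂ = 1/2`. -/
def pointQ5 (k : Fin 3 → ℝ) : Fin 3 → ℝ :=
  let β := (√(k 0 ^ 2 + k 0 * k 1 + k 1 ^ 2) - k 1) / (2 * k 0)
  ![1 / 2 - β, 1 / 2, β]

/-- The value of the invariant at `Q₄`. -/
def I4 (k : Fin 3 → ℝ) : ℝ := invI k (pointQ4 k)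

/-- The value of the invariant at `Q₅`. -/
def I5 (k : Fin 3 → ℝ) : ℝ := invI k (pointQ5 k)

/-- The open arc of the critical curve from the point `a` to the point `b` on its right. -/
def arc (k : Fin 3 → ℝ) (a b : Fin 3 → ℝ) : Set (Fin 3 → ℝ) :=
  {x | x ∈ criticalCurve k ∧ abscissa a < abscissa x ∧ abscissa x < abscissa b}

/-- The point `s` is an intersection of the level curve of the invariant through `Q₄` with the
part of the critical curve on the right of the centroid (up to and including `Q₅`). -/
def IsS4 (k : Fin 3 → ℝ) (s : Fin 3 → ℝ) : Prop :=
  s ∈ criticalCurve k ∧ s 0 < s 1 ∧ invI k s = I4 k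

/-- The point `x` on the side `γ` of the plane represents configurations which stay similar to
themselves while the perimeter changes at a rate satisfying `P`. -/
def IsSelfSimilar (k : Fin 3 → ℝ) (x : Fin 3 → ℝ) (γ : SignType) (P : ℝ → Prop) : Prop :=
  (∃ c : Config, Function.Injective c ∧ tri c = x ∧ orientation c = γ) ∧
  ∀ z : ℝ → Config, SolvesAt k z 0 → tri (z 0) = x → orientation (z 0) = γ →
    (∀ j, HasDerivAt (fun t => tri (z t) j) 0 0) ∧
    ∃ r, P r ∧ HasDerivAt (fun t => perimeter (z t)) r 0

/-- A point of a contracting branch of the critical curve. -/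
def IsContracting (k : Fin 3 → ℝ) (x : Fin 3 → ℝ) (γ : SignType) : Prop :=
  IsSelfSimilar k x γ (fun r => r < 0)

/-- A point of an expanding branch of the critical curve. -/
def IsExpanding (k : Fin 3 → ℝ) (x : Fin 3 → ℝ) (γ : SignType) : Prop :=
  IsSelfSimilar k x γ (fun r => 0 < r)

/-- The planar trajectory of `z` comes, as time tends to `-∞`, from the contracting point `q` on
the side `γ`. -/
def DepartsFrom (k : Fin 3 → ℝ) (z : ℝ → Config) (q : Fin 3 → ℝ) (γ : SignType) : Prop :=
  IsContracting k q γ ∧ Tendsto (fun t => tri (z t)) atBot (𝓝 q) ∧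
    ∀ᶠ t in atBot, orientation (z t) = γ

/-- The planar trajectory of `z` ends, as time tends to `+∞`, at the expanding point `q` on
the side `γ`. -/
def EndsAt (k : Fin 3 → ℝ) (z : ℝ → Config) (q : Fin 3 → ℝ) (γ : SignType) : Prop :=
  IsExpanding k q γ ∧ Tendsto (fun t => tri (z t)) atTop (𝓝 q) ∧
    ∀ᶠ t in atTop, orientation (z t) = γ

/-- The planar trajectory stays on the side `γ` before the time `t₀`, crosses at `t₀` the edge
`x j = 1/2`, and stays on the opposite side afterwards. -/
def CrossesOnce (z : ℝ → Config) (j : Fin 3) (γ : SignType) (t₀ : ℝ) : Prop :=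
  (∀ t < t₀, orientation (z t) = γ) ∧ tri (z t₀) j = 1 / 2 ∧ ∀ t > t₀, orientation (z t) = -γ

/-- The trajectory lies on a level curve of the invariant with value in the set `J`. -/
def OnLevel (k : Fin 3 → ℝ) (z : ℝ → Config) (J : Set ℝ) : Prop :=
  ∃ c ∈ J, ∀ t, invI k (tri (z t)) = c

/-- Type I, on the right: below the critical curve, from `EQ₅` across the edge `Q₃Q₁` to the image
of the departure point on `E*Q₅`. -/
def TypeIRight (k : Fin 3 → ℝ) (z : ℝ → Config) : Prop :=
  OnLevel k z (Ioo (I5 k) 1) ∧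
  (∀ t, formY k (tri (z t)) < 0 ∧ tri (z t) 0 < tri (z t) 1) ∧
  (∃ t₀, CrossesOnce z 1 1 t₀) ∧
  ∃ q ∈ arc k pointE (pointQ5 k), DepartsFrom k z q 1 ∧ EndsAt k z q (-1)

/-- Type I, on the left: below the critical curve, from `E*Q₄` across the edge `Q₂Q₃` to the image
of the departure point on `Q₄E`. -/
def TypeILeft (k : Fin 3 → ℝ) (z : ℝ → Config) : Prop :=
  OnLevel k z (Ioo (I4 k) 1) ∧
  (∀ t, formY k (tri (z t)) < 0 ∧ tri (z t) 1 < tri (z t) 0) ∧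
  (∃ t₀, CrossesOnce z 0 (-1) t₀) ∧
  ∃ q ∈ arc k (pointQ4 k) pointE, DepartsFrom k z q (-1) ∧ EndsAt k z q 1

/-- Type II, positive side: above the critical curve, from `ES₄` to `Q₄E`. -/
def TypeIIPos (k : Fin 3 → ℝ) (s : Fin 3 → ℝ) (z : ℝ → Config) : Prop :=
  OnLevel k z (Ioo (I4 k) 1) ∧ (∀ t, 0 < formY k (tri (z t))) ∧
  (∀ t, orientation (z t) = 1) ∧
  (∃ q ∈ arc k pointE s, DepartsFrom k z q 1) ∧
  ∃ q ∈ arc k (pointQ4 k) pointE, EndsAt k z q 1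

/-- Type II, negative side: above the critical curve, from the image of `Q₄E` to the image of
`ES₄`. -/
def TypeIINeg (k : Fin 3 → ℝ) (s : Fin 3 → ℝ) (z : ℝ → Config) : Prop :=
  OnLevel k z (Ioo (I4 k) 1) ∧ (∀ t, 0 < formY k (tri (z t))) ∧
  (∀ t, orientation (z t) = -1) ∧
  (∃ q ∈ arc k (pointQ4 k) pointE, DepartsFrom k z q (-1)) ∧
  ∃ q ∈ arc k pointE s, EndsAt k z q (-1)

/-- Type III: above the critical curve, from `S₄Q₅` across the edge `Q₂Q₃` to the image of the
departure point on `E*Q₅`. -/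
def TypeIII (k : Fin 3 → ℝ) (s : Fin 3 → ℝ) (z : ℝ → Config) : Prop :=
  OnLevel k z (Ioo (I5 k) (I4 k)) ∧ (∀ t, 0 < formY k (tri (z t))) ∧
  (∃ t₀, CrossesOnce z 0 1 t₀) ∧
  ∃ q ∈ arc k s (pointQ5 k), DepartsFrom k z q 1 ∧ EndsAt k z q (-1)

end ThreeVortex

end

/-! Normalise the strengths to `bK, aK, -abK` with `a + b = 1`, `a ≤ b`, and describe a shape by `u
= R₁/R₃`, `v = R₂/R₃`. Two quantities are conserved: the level `l = a log u + b log v`, which is the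
logarithm of the invariant over `K`, and the angular impulse `M = R₃² - a R₁² - b R₂² = R₃² ·
ellipse`. On a level curve the shape is given by `s = log (v/u)`, and for `M ≠ 0` the size follows
from `R₃² = M / ellipse`. With the signed area `A` the motion becomes planar: `s' = -κ(s) A`, `A' =
μ(s)`, with `A² = Φ(s)` by Heron's formula (`planarFlow_of_isMotion`).

Such a bounded flow, once free of zeros of `A`, converges to a zero of `ellipse`, that is, to a
critical point of its level (`PlanarFlow.exists_tendsto_atTop`). A level `l < 0` has one such point
with `s > 0` and one with `s < 0`; it lies inside the triangle exactly when `l` exceeds the level of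
the corresponding end point Q₅ or Q₄ (`lt_one_add_iff`). Zeros of `A` are collinear shapes. Levels
above that of Q₅ miss the edge `x₃ = 1/2` (`add_ne_one`), and on the other two edges `A'` has a sign
fixed by the edge and by the sign of `ellipse` (`areaRate_edge_one`, `areaRate_edge_zero`).

The types result from counting. Below the curve, or above it at a level between those of Q₅ and Q₄,
only one critical point is available as a limit. A motion without turning point would make `s`
strictly monotone with equal limits, so `A` vanishes, and only once because `A'` has one sign at its
zeros (`PlanarFlow.exists_crossing`). Above the curve at a level above that of Q₄, neither edge is
reachable (`ellipse_neg_of_edge`); then `A` keeps its sign and `s` runs monotonically between the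
two critical points.

Global existence holds because a level `l < 0` and `M ≠ 0` bound all sides from below
(`exists_side_bound`), so the local existence time is uniform. Contraction and expansion are read
off from the common relative rate of the sides on the critical curve, which has the sign of `A (u -
v)`. -/

namespace ThreeVortex

/-! ### The plane of trilinear coordinates in terms of the ratios of sides -/

/-- The logarithm of the invariant, normalised, in terms of the ratios `u = R₁/R₃`, `v = R₂/R₃`. -/
noncomputable def logLevel (a b u v : ℝ) : ℝ := a * Real.log u + b * Real.log v

/-- The quadratic form of the critical curve, normalised, in terms of the ratios of sides. -/
def ellipse (a b u v : ℝ) : ℝ := 1 - a * u ^ 2 - b * v ^ 2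

/-- The trilinear coordinates of the triangle with sides `u`, `v`, `1`. -/
noncomputable def shape (u v : ℝ) : Fin 3 → ℝ :=
  ![u / (1 + u + v), v / (1 + u + v), 1 / (1 + u + v)]

/-- The strengths in terms of their normalised values `b`, `a`, `-ab`. -/
def scaledStrength (K a b : ℝ) : Fin 3 → ℝ := ![b * K, a * K, -(a * b * K)]

/-- Exchanging the first two vortices exchanges `a` with `b` and `u` with `v`. By this symmetry the
left half of the critical curve inherits what is proved for the right half. -/
lemma logLevel_swap (a b u v : ℝ) : logLevel a b u v = logLevel b a v u := by
  unfold logLevel; ring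

lemma ellipse_swap (a b u v : ℝ) : ellipse a b u v = ellipse b a v u := by
  unfold ellipse; ring

section Plane

variable {a b : ℝ} (ha : 0 < a) (hb : 0 < b) (hab : a + b = 1)

include ha hb in
/-- The logarithm lies below its tangent. -/
lemma logLevel_sub_le {u v u' v' : ℝ} (hu : 0 < u) (hv : 0 < v) (hu' : 0 < u') (hv' : 0 < v') :
    logLevel a b u' v' - logLevel a b u v ≤ a * (u' / u - 1) + b * (v' / v - 1) := by
  have h1 := Real.log_le_sub_one_of_pos (div_pos hu' hu)
  have h2 := Real.log_le_sub_one_of_pos (div_pos hv' hv)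
  rw [Real.log_div hu'.ne' hu.ne'] at h1
  rw [Real.log_div hv'.ne' hv.ne'] at h2
  have := mul_le_mul_of_nonneg_left h1 ha.le
  have := mul_le_mul_of_nonneg_left h2 hb.le
  unfold logLevel; linarith

include ha hb in
lemma logLevel_le_of_le {u v u' v' : ℝ} (hu : 0 < u) (hv : 0 < v) (h : u ≤ u') (h' : v ≤ v') :
    logLevel a b u v ≤ logLevel a b u' v' := by
  have h1 := mul_le_mul_of_nonneg_left (Real.log_le_log hu h) ha.le
  have h2 := mul_le_mul_of_nonneg_left (Real.log_le_log hv h') hb.le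
  unfold logLevel; linarith

include ha hb hab in
/-- The invariant is bounded on the edge `x₃ = 1/2`. -/
lemma logLevel_le_of_add_eq_one {u v : ℝ} (hu : 0 < u) (hv : 0 < v) (h : u + v = 1) :
    logLevel a b u v ≤ logLevel a b a b := by
  -- The gradient at `(a, b)` is `(1, 1)`, so the tangent there is constant along the edge.
  have := logLevel_sub_le ha hb ha hb hu hv
  have e : a * (u / a - 1) + b * (v / b - 1) = 0 := by field_simp; linarith
  linarith

include ha hb hab in
/-- On the right part of the critical curve the invariant decreases to the right. -/
lemma logLevel_lt_of_ellipse {u v u' v' : ℝ} (hu : 0 < u) (hu' : 0 < u') (huv : u ≤ v)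
    (hvv : v < v') (he : ellipse a b u v = 0) (he' : ellipse a b u' v' = 0) :
    logLevel a b u' v' < logLevel a b u v := by
  have hv : 0 < v := hu.trans_le huv
  have hv' : 0 < v' := hv.trans hvv
  unfold ellipse at he he'
  have hr : 1 < v' / v := by rwa [one_lt_div hv]
  -- The tangent bound is applied to the squares, in which the critical curve is a straight line.
  have h2 := Real.log_lt_sub_one_of_pos (x := (v' / v) ^ 2) (by positivity)
    (by nlinarith)
  have h1 := Real.log_le_sub_one_of_pos (x := (u' / u) ^ 2) (by positivity)
  rw [Real.log_pow, Real.log_div hu'.ne' hu.ne'] at h1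
  rw [Real.log_pow, Real.log_div hv'.ne' hv.ne'] at h2
  push_cast at h1 h2
  have h3 : a * ((u' / u) ^ 2 - 1) + b * ((v' / v) ^ 2 - 1) ≤ 0 := by
    have : a * ((u' / u) ^ 2 - 1) + b * ((v' / v) ^ 2 - 1)
        = (b * (v' ^ 2 - v ^ 2)) * (1 / v ^ 2 - 1 / u ^ 2) := by
      have : a * (u' ^ 2 - u ^ 2) = - (b * (v' ^ 2 - v ^ 2)) := by linarith
      have e1 : a * ((u' / u) ^ 2 - 1) = a * (u' ^ 2 - u ^ 2) * (1 / u ^ 2) := by field_simp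
      rw [e1, this]; field_simp; ring
    rw [this]
    apply mul_nonpos_of_nonneg_of_nonpos
    · have : v ^ 2 < v' ^ 2 := by gcongr
      nlinarith
    · have : 1 / v ^ 2 ≤ 1 / u ^ 2 := by gcongr
      linarith
  have := mul_le_mul_of_nonneg_left h1 ha.le
  have := mul_lt_mul_of_pos_left h2 hb
  unfold logLevel; linarith

include ha hb in
lemma lt_iff_lt_of_ellipse {u v u' v' : ℝ} (hu : 0 < u) (hu' : 0 < u') (hv : 0 < v) (hv' : 0 < v')
    (he : ellipse a b u v = 0) (he' : ellipse a b u' v' = 0) : v < v' ↔ u' < u := by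
  unfold ellipse at he he'
  rw [← sq_lt_sq₀ hv.le hv'.le, ← sq_lt_sq₀ hu'.le hu.le, ← mul_lt_mul_iff_right₀ hb,
    ← mul_lt_mul_iff_right₀ (b := u' ^ 2) ha]
  constructor <;> intro <;> linarith

include ha hb in
lemma eq_of_ellipse_of_eq {u v u' v' : ℝ} (hu : 0 < u) (hu' : 0 < u') (hv : 0 < v) (hv' : 0 < v')
    (he : ellipse a b u v = 0) (he' : ellipse a b u' v' = 0) (h : v = v') : u = u' := by
  have h1 := lt_iff_lt_of_ellipse ha hb hu hu' hv hv' he he'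
  have h2 := lt_iff_lt_of_ellipse ha hb hu' hu hv' hv he' he
  rcases lt_trichotomy u u' with h | h | h
  · have := h2.2 h; linarith
  · exact h
  · have := h1.2 h; linarith

include hab in
lemma ellipse_one_one : ellipse a b 1 1 = 0 := by unfold ellipse; linarith

lemma logLevel_one_one : logLevel a b 1 1 = 0 := by simp [logLevel]

include ha hb hab in
lemma one_lt_of_ellipse {u v : ℝ} (hu : 0 < u) (huv : u < v) (he : ellipse a b u v = 0) :
    1 < v := by
  by_contra! h
  have h1 : v ^ 2 ≤ 1 := by nlinarith
  have h2 : u ^ 2 < 1 := by nlinarith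
  unfold ellipse at he
  nlinarith

include ha hb hab in
/-- The invariant is less than one on the right part of the critical curve. -/
lemma logLevel_neg_of_ellipse {u v : ℝ} (hu : 0 < u) (huv : u < v) (he : ellipse a b u v = 0) :
    logLevel a b u v < 0 := by
  have := logLevel_lt_of_ellipse ha hb hab one_pos hu le_rfl
    (one_lt_of_ellipse ha hb hab hu huv he) (ellipse_one_one hab) he
  rwa [logLevel_one_one] at this

include ha hb hab in
-- Monotonicity read backwards: on the right part of the curve the level serves as a coordinate.
lemma lt_of_logLevel_lt {u v u' v' : ℝ} (hu : 0 < u) (hu' : 0 < u') (huv : u ≤ v)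
    (huv' : u' ≤ v') (he : ellipse a b u v = 0) (he' : ellipse a b u' v' = 0)
    (hl : logLevel a b u' v' < logLevel a b u v) : v < v' := by
  by_contra! h
  rcases h.lt_or_eq with h | h
  · have := logLevel_lt_of_ellipse ha hb hab hu' hu huv' h he' he; linarith
  · have := eq_of_ellipse_of_eq ha hb hu' hu (hu'.trans_le huv') (hu.trans_le huv) he' he h
    subst h this; exact lt_irrefl _ hl

include ha hb hab in
lemma eq_of_logLevel_eq {u v u' v' : ℝ} (hu : 0 < u) (hu' : 0 < u') (huv : u ≤ v)
    (huv' : u' ≤ v') (he : ellipse a b u v = 0) (he' : ellipse a b u' v' = 0)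
    (hl : logLevel a b u' v' = logLevel a b u v) : u = u' ∧ v = v' := by
  have hvv : v = v' := by
    rcases lt_trichotomy v v' with h | h | h
    · have := logLevel_lt_of_ellipse ha hb hab hu hu' huv h he he'; linarith
    · exact h
    · have := logLevel_lt_of_ellipse ha hb hab hu' hu huv' h he' he; linarith
  exact ⟨eq_of_ellipse_of_eq ha hb hu hu' (hu.trans_le huv) (hu'.trans_le huv') he he' hvv, hvv⟩

/-! ### The end points of the critical curve -/

include ha hb hab in
lemma mul_lt_one_sub : 0 < 1 - a * b := by nlinarith

/-- The semiaxis entering the end points of the critical curve. -/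
noncomputable def endRoot (a b : ℝ) : ℝ := √(1 - a * b)

lemma endRoot_swap (a b : ℝ) : endRoot a b = endRoot b a := by unfold endRoot; rw [mul_comm]

include ha hb hab in
lemma endRoot_sq : endRoot a b ^ 2 = 1 - a * b :=
  Real.sq_sqrt (mul_lt_one_sub ha hb hab).le

include ha hb hab in
lemma endRoot_pos : 0 < endRoot a b := Real.sqrt_pos.2 (mul_lt_one_sub ha hb hab)

include ha hb hab in
lemma lt_endRoot : a < endRoot a b := by
  have := endRoot_sq ha hb hab
  have := endRoot_pos ha hb hab
  nlinarith

include ha hb hab in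
lemma endRoot_lt_one : endRoot a b < 1 := by
  have := endRoot_sq ha hb hab
  have := endRoot_pos ha hb hab
  have := mul_pos ha hb
  nlinarith

include ha hb hab in
lemma lt_endRoot' : b < endRoot a b := by
  rw [endRoot_swap]; exact lt_endRoot hb ha (by linarith)

include ha hb hab in
-- Substituting the edge `v = 1 + u` leaves `u² + 2bu - a = 0`, whose positive root is `w - b` with
-- `w² = b² + a = 1 - ab`.
lemma ellipse_end : ellipse a b (endRoot a b - b) (endRoot a b + a) = 0 := by
  have := endRoot_sq ha hb hab
  obtain rfl : b = 1 - a := by linarith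
  unfold ellipse; linear_combination -this

/-- The level of the right end point of the critical curve. -/
noncomputable def endLevel (a b : ℝ) : ℝ := logLevel a b (endRoot a b - b) (endRoot a b + a)

include ha hb hab in
lemma endLevel_neg : endLevel a b < 0 :=
  logLevel_neg_of_ellipse ha hb hab (by linarith [lt_endRoot' ha hb hab])
    (by linarith) (ellipse_end ha hb hab)

include ha hb hab in
/-- The level curves beyond the end point do not meet the edge `x₃ = 1/2`. -/
lemma lt_endLevel : logLevel a b a b < endLevel a b := by
  have hw := endRoot_sq ha hb hab
  have h1 := lt_endRoot' ha hb hab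
  have h0 := endRoot_lt_one ha hb hab
  have hp := endRoot_pos ha hb hab
  have hu : 0 < endRoot a b - b := by linarith
  have hv : 0 < endRoot a b + a := by linarith
  -- Tangent at the end point: `(w - b)(w + b) = a` and `(w + a)(w - a) = b` simplify the quotients
  -- and leave the bound `w - 1 < 0`.
  have := logLevel_sub_le ha hb hu hv ha hb
  have e1 : a / (endRoot a b - b) = endRoot a b + b := by
    obtain rfl : b = 1 - a := by linarith
    rw [div_eq_iff hu.ne']; linear_combination -hw
  have e2 : b / (endRoot a b + a) = endRoot a b - a := by
    obtain rfl : b = 1 - a := by linarith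
    rw [div_eq_iff hv.ne']; linear_combination -hw
  rw [e1, e2] at this
  have : logLevel a b a b - endLevel a b ≤ endRoot a b - 1 := by
    unfold endLevel
    obtain rfl : b = 1 - a := by linarith
    linarith
  linarith

include ha hb hab in
lemma add_ne_one {u v : ℝ} (hu : 0 < u) (hv : 0 < v) (h : endLevel a b < logLevel a b u v) :
    u + v ≠ 1 := fun h1 => by
  have := logLevel_le_of_add_eq_one ha hb hab hu hv h1
  have := lt_endLevel ha hb hab
  linarith

include ha hb hab in
/-- On the edge `x₂ = 1/2` the level curves beyond the end point lie below the critical curve. -/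
lemma ellipse_neg_of_edge {u v : ℝ} (hu : 0 < u) (hv : v = 1 + u)
    (h : endLevel a b < logLevel a b u v) : ellipse a b u v < 0 := by
  by_contra! he
  have hw := endRoot_sq ha hb hab
  have h1 := lt_endRoot' ha hb hab
  -- On this edge the form equals `a - u² - 2bu`, which is nonnegative only up to the end point.
  have hle : u ≤ endRoot a b - b := by
    by_contra! hlt
    subst hv
    unfold ellipse at he
    obtain rfl : a = 1 - b := by linarith
    nlinarith
  have := logLevel_le_of_le ha hb hu (by linarith) hle (show v ≤ endRoot a b + a by linarith)
  unfold endLevel at h; linarith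

include ha hb hab in
/-- A point of the right part of the critical curve lies inside the triangle iff its level exceeds
that of the end point. -/
lemma lt_one_add_iff {u v : ℝ} (hu : 0 < u) (huv : u < v) (he : ellipse a b u v = 0) :
    v < 1 + u ↔ endLevel a b < logLevel a b u v := by
  have h1 := lt_endRoot' ha hb hab
  have hee := ellipse_end ha hb hab
  have hu5 : 0 < endRoot a b - b := by linarith
  -- Along the curve `u` falls as `v` grows, so `v - u` passes the value 1 only at the end point.
  have key := lt_iff_lt_of_ellipse ha hb hu hu5 (hu.trans huv) (by linarith) he hee
  constructor
  · intro h
    refine logLevel_lt_of_ellipse ha hb hab hu hu5 huv.le ?_ he hee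
    by_contra! hge
    have : u ≤ endRoot a b - b := not_lt.1 fun h' => absurd (key.2 h') (not_lt.2 hge)
    linarith
  · intro h
    have h2 := lt_of_logLevel_lt ha hb hab hu hu5 huv.le (by linarith) he hee h
    have := key.1 h2
    linarith

include ha hb hab in
-- The case of equality is needed for `k₁ = k₂`, when S₄ coincides with Q₅.
lemma le_one_add_of_endLevel_le {u v : ℝ} (hu : 0 < u) (huv : u < v) (he : ellipse a b u v = 0)
    (h : endLevel a b ≤ logLevel a b u v) : v ≤ 1 + u := by
  rcases h.lt_or_eq with h | h
  · exact ((lt_one_add_iff ha hb hab hu huv he).2 h).le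
  · have h1 := lt_endRoot' ha hb hab
    obtain ⟨h2, h3⟩ := eq_of_logLevel_eq ha hb hab hu (by linarith) huv.le
      (show endRoot a b - b ≤ endRoot a b + a by linarith) he (ellipse_end ha hb hab) h
    linarith

/-- The function `artanh x / x` is increasing. -/
lemma mul_log_sub_le {x y : ℝ} (hx : 0 < x) (hxy : x ≤ y) (hy : y < 1) :
    y * (Real.log (1 + x) - Real.log (1 - x)) ≤ x * (Real.log (1 + y) - Real.log (1 - y)) := by
  have h1 := (Real.hasSum_log_sub_log_of_abs_lt_one (x := x)
    (by rw [abs_of_pos hx]; linarith)).mul_left y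
  have h2 := (Real.hasSum_log_sub_log_of_abs_lt_one (x := y)
    (by rw [abs_of_pos (hx.trans_le hxy)]; linarith)).mul_left x
  refine hasSum_le (fun n => ?_) h1 h2
  -- The `n`-th terms of the two odd power series share the factor `x * y` and differ only in these
  -- even powers.
  have : x ^ (2 * n) ≤ y ^ (2 * n) := by gcongr
  have h3 : 0 ≤ 2 * (1 / (2 * (n : ℝ) + 1)) * (x * y) := by
    have := hx.trans_le hxy
    positivity
  have := mul_le_mul_of_nonneg_left this h3
  calc _ = 2 * (1 / (2 * (n : ℝ) + 1)) * (x * y) * x ^ (2 * n) := by ring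
    _ ≤ _ := this
    _ = _ := by ring

include ha hb hab in
-- With `w = endRoot a b` the difference of the two levels is `a (log (w + b) - log (w - b)) - b
-- (log (w + a) - log (w - a))`, so this is the monotonicity of `artanh x / x` between `a / w` and
-- `b / w`. The order `k₂ ≤ k₁` thus places Q₅ at a level not above that of Q₄.
lemma endLevel_le_swap (hle : a ≤ b) : endLevel a b ≤ endLevel b a := by
  have h1 := lt_endRoot ha hb hab
  have h2 := lt_endRoot' ha hb hab
  unfold endLevel logLevel
  rw [endRoot_swap b a]
  set w := endRoot a b
  have hw : 0 < w := endRoot_pos ha hb hab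
  have key := mul_log_sub_le (div_pos ha hw) (div_le_div_of_nonneg_right hle hw.le)
    ((div_lt_one hw).2 h2)
  have e : ∀ c, 0 < c → c < w → Real.log (1 + c / w) - Real.log (1 - c / w)
      = Real.log (w + c) - Real.log (w - c) := by
    intro c hc hcw
    have e1 : 1 + c / w = (w + c) / w := by field_simp
    have e2 : 1 - c / w = (w - c) / w := by field_simp
    rw [e1, e2, Real.log_div (by linarith) hw.ne', Real.log_div (by linarith) hw.ne']; ring
  rw [e a ha h1, e b hb h2] at key
  have := mul_le_mul_of_nonneg_left key hw.le
  have e3 : ∀ c x, w * (c / w * x) = c * x := fun c x => by field_simp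
  rw [e3, e3] at this
  linarith

/-! ### Trilinear coordinates -/

lemma shape_zero (u v : ℝ) : shape u v 0 = u / (1 + u + v) := rfl
lemma shape_one (u v : ℝ) : shape u v 1 = v / (1 + u + v) := rfl
lemma shape_two (u v : ℝ) : shape u v 2 = 1 / (1 + u + v) := rfl

lemma pointE_eq_shape : pointE = shape 1 1 := by
  funext i; fin_cases i <;> simp [pointE, shape] <;> norm_num

lemma shape_lt_iff {u v : ℝ} (hu : 0 < u) (hv : 0 < v) : shape u v 0 < shape u v 1 ↔ u < v := by
  rw [shape_zero, shape_one, div_lt_div_iff_of_pos_right (by positivity)]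

lemma shape_lt_iff' {u v : ℝ} (hu : 0 < u) (hv : 0 < v) : shape u v 1 < shape u v 0 ↔ v < u := by
  rw [shape_zero, shape_one, div_lt_div_iff_of_pos_right (by positivity)]

lemma invI_shape {K u v : ℝ} (hu : 0 < u) (hv : 0 < v) :
    invI (scaledStrength K a b) (shape u v) = Real.exp (K * logLevel a b u v) := by
  have h : 0 < 1 + u + v := by positivity
  have e1 : u / (1 + u + v) / (1 / (1 + u + v)) = u := by field_simp
  have e2 : v / (1 + u + v) / (1 / (1 + u + v)) = v := by field_simp
  simp only [invI, shape_zero, shape_one, shape_two, e1, e2, scaledStrength]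
  rw [Real.rpow_def_of_pos hu, Real.rpow_def_of_pos hv, ← Real.exp_add]
  simp only [Matrix.cons_val_one, Matrix.cons_val_zero, logLevel]
  ring_nf

lemma formY_shape {K u v : ℝ} (hu : 0 < u) (hv : 0 < v) :
    formY (scaledStrength K a b) (shape u v)
      = a * b * K ^ 2 / (1 + u + v) ^ 2 * ellipse a b u v := by
  have h : 0 < 1 + u + v := by positivity
  simp [formY, shape, scaledStrength, ellipse]
  field_simp
  ring

lemma shape_mem_triangleQ {u v : ℝ} (hu : 0 < u) (hv : 0 < v) :
    shape u v ∈ triangleQ ↔ u ≤ 1 + v ∧ v ≤ 1 + u ∧ 1 ≤ u + v := by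
  have h : 0 < 1 + u + v := by positivity
  have e : ∀ x, 0 < x → (0 ≤ x / (1 + u + v) ∧ x / (1 + u + v) ≤ 1 / 2 ↔ 2 * x ≤ 1 + u + v) := by
    intro x hx
    rw [div_le_div_iff₀ h two_pos]
    constructor
    · rintro ⟨-, h⟩; linarith
    · intro h; exact ⟨by positivity, by linarith⟩
  have hs : u / (1 + u + v) + v / (1 + u + v) + 1 / (1 + u + v) = 1 := by field_simp; ring
  simp only [triangleQ, mem_ofPred_eq, Fin.sum_univ_three, Fin.forall_fin_succ, shape_zero,
    shape_one, shape_two]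
  simp only [Fin.succ_zero_eq_one, shape_one, Fin.succ_one_eq_two, shape_two, hs, true_and,
    IsEmpty.forall_iff, and_true, e u hu, e v hv, e 1 one_pos]
  constructor
  · rintro ⟨h1, h2, h3⟩; exact ⟨by linarith, by linarith, by linarith⟩
  · rintro ⟨h1, h2, h3⟩; exact ⟨by linarith, by linarith, by linarith⟩

lemma eq_shape_of_sum {x : Fin 3 → ℝ} (h2 : 0 < x 2) (hs : ∑ j, x j = 1) :
    x = shape (x 0 / x 2) (x 1 / x 2) := by
  rw [Fin.sum_univ_three] at hs
  have e : 1 + x 0 / x 2 + x 1 / x 2 = 1 / x 2 := by field_simp; linarith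
  funext i; fin_cases i <;> simp [shape, e] <;> field_simp

lemma abscissa_shape (u v : ℝ) : abscissa (shape u v) = (v - u) / (1 + u + v) / √3 := by
  unfold abscissa; rw [shape_zero, shape_one]; ring

include ha hb in
/-- The critical curve is a graph over the abscissa. -/
lemma abscissa_lt_of_ellipse {u v u' v' : ℝ} (hu : 0 < u) (hu' : 0 < u') (hv : 0 < v)
    (hvv : v < v') (he : ellipse a b u v = 0) (he' : ellipse a b u' v' = 0) :
    abscissa (shape u v) < abscissa (shape u' v') := by
  have huu := (lt_iff_lt_of_ellipse ha hb hu hu' hv (hv.trans hvv) he he').1 hvv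
  rw [abscissa_shape, abscissa_shape]
  apply div_lt_div_of_pos_right _ (by positivity)
  rw [div_lt_div_iff₀ (by positivity) (by linarith)]
  nlinarith [mul_lt_mul'' huu hvv hu'.le hv.le]

/-! ### The named points, levels and arcs of the critical curve -/

variable {K : ℝ} (hK : 0 < K)

include ha hb hab hK in
lemma sqrt_scaledStrength :
    √(scaledStrength K a b 0 ^ 2 + scaledStrength K a b 0 * scaledStrength K a b 1
      + scaledStrength K a b 1 ^ 2) = K * endRoot a b := by
  have := endRoot_pos ha hb hab
  rw [Real.sqrt_eq_iff_mul_self_eq_of_pos (by positivity)]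
  have := endRoot_sq ha hb hab
  simp only [scaledStrength, Matrix.cons_val_zero, Matrix.cons_val_one]
  obtain rfl : b = 1 - a := by linarith
  linear_combination K ^ 2 * this

include ha hb hab hK in
lemma pointQ5_eq_shape : pointQ5 (scaledStrength K a b)
    = shape (endRoot a b - b) (endRoot a b + a) := by
  have hw := endRoot_sq ha hb hab
  have hp := endRoot_pos ha hb hab
  unfold pointQ5
  rw [sqrt_scaledStrength ha hb hab hK]
  -- On the edge the perimeter is twice the longest side; with `(w - a)(w + a) = b` this identifies
  -- `β` as `1 / (1 + u + v)`.
  have e : 1 + (endRoot a b - b) + (endRoot a b + a) = 2 * (endRoot a b + a) := by linarith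
  have e2 : (K * endRoot a b - scaledStrength K a b 1) / (2 * scaledStrength K a b 0)
      = 1 / (2 * (endRoot a b + a)) := by
    simp only [scaledStrength, Matrix.cons_val_zero, Matrix.cons_val_one]
    rw [div_eq_div_iff (by positivity) (by positivity)]
    obtain rfl : b = 1 - a := by linarith
    linear_combination 2 * K * hw
  rw [e2]
  unfold shape
  rw [e]
  have : 0 < endRoot a b + a := by positivity
  funext i; fin_cases i <;> simp <;> field_simp
  linarith

include ha hb hab hK in
lemma pointQ4_eq_shape : pointQ4 (scaledStrength K a b)
    = shape (endRoot a b + b) (endRoot a b - a) := by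
  have hw := endRoot_sq ha hb hab
  have hp := endRoot_pos ha hb hab
  unfold pointQ4
  rw [sqrt_scaledStrength ha hb hab hK]
  have e : 1 + (endRoot a b + b) + (endRoot a b - a) = 2 * (endRoot a b + b) := by linarith
  have e2 : (K * endRoot a b - scaledStrength K a b 0) / (2 * scaledStrength K a b 1)
      = 1 / (2 * (endRoot a b + b)) := by
    simp only [scaledStrength, Matrix.cons_val_zero, Matrix.cons_val_one]
    rw [div_eq_div_iff (by positivity) (by positivity)]
    obtain rfl : b = 1 - a := by linarith
    linear_combination 2 * K * hw
  rw [e2]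
  unfold shape
  rw [e]
  have : 0 < endRoot a b + b := by positivity
  funext i; fin_cases i <;> simp <;> field_simp
  linarith

include ha hb hab hK in
lemma I5_eq : I5 (scaledStrength K a b) = Real.exp (K * endLevel a b) := by
  have := lt_endRoot' ha hb hab
  rw [I5, pointQ5_eq_shape ha hb hab hK, invI_shape (by linarith) (by linarith), endLevel]

include ha hb hab hK in
lemma I4_eq : I4 (scaledStrength K a b) = Real.exp (K * endLevel b a) := by
  have := lt_endRoot ha hb hab
  rw [I4, pointQ4_eq_shape ha hb hab hK, invI_shape (by linarith) (by linarith), endLevel,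
    logLevel_swap, endRoot_swap]

include ha hb hab in
-- If `u + v ≤ 1`, both ratios are below one and the form is positive. Hence only two triangle
-- inequalities need checking on the critical curve.
lemma one_lt_add_of_ellipse {u v : ℝ} (hu : 0 < u) (hv : 0 < v) (he : ellipse a b u v = 0) :
    1 < u + v := by
  by_contra! h
  unfold ellipse at he
  have hu1 : u ^ 2 < 1 := by nlinarith
  have hv1 : v ^ 2 < 1 := by nlinarith
  nlinarith

include ha hb hab hK in
lemma shape_mem_criticalCurve {u v : ℝ} (hu : 0 < u) (hv : 0 < v) :
    shape u v ∈ criticalCurve (scaledStrength K a b) ↔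
      (u ≤ 1 + v ∧ v ≤ 1 + u) ∧ ellipse a b u v = 0 := by
  rw [criticalCurve, mem_ofPred_eq, shape_mem_triangleQ hu hv, formY_shape hu hv, mul_eq_zero,
    or_iff_right (by positivity)]
  refine ⟨fun ⟨⟨h1, h2, _⟩, h3⟩ => ⟨⟨h1, h2⟩, h3⟩,
    fun ⟨⟨h1, h2⟩, h3⟩ => ⟨⟨h1, h2, (one_lt_add_of_ellipse ha hb hab hu hv h3).le⟩, h3⟩⟩

include ha hb hab hK in
/-- The points of the right part of the critical curve between two levels. -/
lemma shape_mem_arc_right {u v u₁ v₁ u₂ v₂ : ℝ} (hu : 0 < u) (huv : u < v)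
    (he : ellipse a b u v = 0) (hl : endLevel a b < logLevel a b u v)
    (hu₁ : 0 < u₁) (huv₁ : u₁ ≤ v₁) (he₁ : ellipse a b u₁ v₁ = 0)
    (hu₂ : 0 < u₂) (huv₂ : u₂ ≤ v₂) (he₂ : ellipse a b u₂ v₂ = 0)
    (h₁ : logLevel a b u v < logLevel a b u₁ v₁) (h₂ : logLevel a b u₂ v₂ < logLevel a b u v) :
    shape u v ∈ arc (scaledStrength K a b) (shape u₁ v₁) (shape u₂ v₂) := by
  refine ⟨(shape_mem_criticalCurve ha hb hab hK hu (hu.trans huv)).2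
    ⟨⟨by linarith, ((lt_one_add_iff ha hb hab hu huv he).2 hl).le⟩, he⟩, ?_, ?_⟩
  · exact abscissa_lt_of_ellipse ha hb hu₁ hu (hu₁.trans_le huv₁)
      (lt_of_logLevel_lt ha hb hab hu₁ hu huv₁ huv.le he₁ he h₁) he₁ he
  · exact abscissa_lt_of_ellipse ha hb hu hu₂ (hu.trans huv)
      (lt_of_logLevel_lt ha hb hab hu hu₂ huv.le huv₂ he he₂ h₂) he he₂

include ha hb hab hK in
lemma shape_mem_arc_E_Q5 {u v : ℝ} (hu : 0 < u) (huv : u < v)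
    (he : ellipse a b u v = 0) (hl : endLevel a b < logLevel a b u v) :
    shape u v ∈ arc (scaledStrength K a b) pointE (pointQ5 (scaledStrength K a b)) := by
  have := lt_endRoot' ha hb hab
  rw [pointE_eq_shape, pointQ5_eq_shape ha hb hab hK]
  refine shape_mem_arc_right ha hb hab hK hu huv he hl one_pos le_rfl (ellipse_one_one hab)
    (by linarith) (by linarith) (ellipse_end ha hb hab) ?_ hl
  rw [logLevel_one_one]; exact logLevel_neg_of_ellipse ha hb hab hu huv he

include ha hb hab hK in
lemma shape_mem_arc_Q4_E {u v : ℝ} (hv : 0 < v) (huv : v < u)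
    (he : ellipse a b u v = 0) (hl : endLevel b a < logLevel a b u v) :
    shape u v ∈ arc (scaledStrength K a b) (pointQ4 (scaledStrength K a b)) pointE := by
  have hba : b + a = 1 := by linarith
  have hwa := lt_endRoot ha hb hab
  have he' := he
  rw [ellipse_swap] at he'
  rw [logLevel_swap] at hl
  have h4 := ellipse_end hb ha hba
  rw [endRoot_swap] at h4
  have h4' := h4
  rw [ellipse_swap] at h4'
  have hu : 0 < u := hv.trans huv
  rw [pointE_eq_shape, pointQ4_eq_shape ha hb hab hK]
  refine ⟨(shape_mem_criticalCurve ha hb hab hK hu hv).2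
    ⟨⟨((lt_one_add_iff hb ha hba hv huv he').2 hl).le, by linarith⟩, he⟩, ?_, ?_⟩
  · refine abscissa_lt_of_ellipse ha hb (by linarith) hu (by linarith) ?_ h4' he
    -- The exchanged lemmas order points by `u`, which decreases as `v` increases.
    rw [lt_iff_lt_of_ellipse ha hb (by linarith) hu (by linarith) hv h4' he]
    refine lt_of_logLevel_lt hb ha hba hv (by linarith) huv.le (by linarith) he' h4 ?_
    rwa [endLevel, endRoot_swap] at hl
  · refine abscissa_lt_of_ellipse ha hb hu one_pos hv ?_ he (ellipse_one_one hab)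
    rw [lt_iff_lt_of_ellipse ha hb hu one_pos hv one_pos he (ellipse_one_one hab)]
    exact one_lt_of_ellipse hb ha hba hv huv he'

end Plane

end ThreeVortex

namespace ThreeVortex

/-! ### Sides and area of a configuration -/

lemma side_zero (c : Config) : side c 0 = ‖c 1 - c 2‖ := rfl
lemma side_one (c : Config) : side c 1 = ‖c 2 - c 0‖ := rfl
lemma side_two (c : Config) : side c 2 = ‖c 0 - c 1‖ := rfl

lemma side_pos {c : Config} (hc : Function.Injective c) (j : Fin 3) : 0 < side c j := by
  refine norm_pos_iff.2 (sub_ne_zero.2 fun h => ?_)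
  have := hc h
  revert this; fin_cases j <;> decide

lemma sq_side_zero (c : Config) :
    side c 0 ^ 2 = ((c 1).re - (c 2).re) ^ 2 + ((c 1).im - (c 2).im) ^ 2 := by
  rw [side_zero, ← Complex.normSq_eq_norm_sq, Complex.normSq_apply, Complex.sub_re, Complex.sub_im]
  ring

lemma sq_side_one (c : Config) :
    side c 1 ^ 2 = ((c 2).re - (c 0).re) ^ 2 + ((c 2).im - (c 0).im) ^ 2 := by
  rw [side_one, ← Complex.normSq_eq_norm_sq, Complex.normSq_apply, Complex.sub_re, Complex.sub_im]
  ring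

lemma sq_side_two (c : Config) :
    side c 2 ^ 2 = ((c 0).re - (c 1).re) ^ 2 + ((c 0).im - (c 1).im) ^ 2 := by
  rw [side_two, ← Complex.normSq_eq_norm_sq, Complex.normSq_apply, Complex.sub_re, Complex.sub_im]
  ring

lemma signedArea_eq (c : Config) : signedArea c = (((c 1).re - (c 0).re) * ((c 2).im - (c 0).im)
    - ((c 1).im - (c 0).im) * ((c 2).re - (c 0).re)) / 2 := by
  simp only [signedArea, Complex.mul_im, Complex.conj_re, Complex.conj_im, Complex.sub_re,
    Complex.sub_im]
  ring

/-- Heron's formula. -/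
lemma heron (c : Config) : 16 * signedArea c ^ 2 =
    (side c 0 + side c 1 + side c 2) * (side c 0 + side c 1 - side c 2)
      * (side c 1 + side c 2 - side c 0) * (side c 2 + side c 0 - side c 1) := by
  have e : (side c 0 + side c 1 + side c 2) * (side c 0 + side c 1 - side c 2)
      * (side c 1 + side c 2 - side c 0) * (side c 2 + side c 0 - side c 1)
      = 2 * (side c 0 ^ 2 * side c 1 ^ 2 + side c 1 ^ 2 * side c 2 ^ 2 + side c 2 ^ 2 * side c 0 ^ 2)
        - (side c 0 ^ 2) ^ 2 - (side c 1 ^ 2) ^ 2 - (side c 2 ^ 2) ^ 2 := by ring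
  rw [e, sq_side_zero, sq_side_one, sq_side_two, signedArea_eq]
  ring

lemma side_triangle (c : Config) : side c 0 ≤ side c 1 + side c 2 ∧
    side c 1 ≤ side c 2 + side c 0 ∧ side c 2 ≤ side c 0 + side c 1 := by
  simp only [side_zero, side_one, side_two]
  refine ⟨?_, ?_, ?_⟩
  · rw [← norm_neg]; refine le_trans (le_of_eq ?_) (norm_add_le _ _); ring_nf
  · rw [← norm_neg]; refine le_trans (le_of_eq ?_) (norm_add_le _ _); ring_nf
  · rw [← norm_neg]; refine le_trans (le_of_eq ?_) (norm_add_le _ _); ring_nf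

lemma perimeter_eq (c : Config) : perimeter c = side c 0 + side c 1 + side c 2 := by
  rw [perimeter, Fin.sum_univ_three]

lemma tri_eq_shape {c : Config} (hc : Function.Injective c) :
    tri c = shape (side c 0 / side c 2) (side c 1 / side c 2) := by
  have h0 := side_pos hc 0
  have h1 := side_pos hc 1
  have h2 := side_pos hc 2
  have e : 1 + side c 0 / side c 2 + side c 1 / side c 2 = perimeter c / side c 2 := by
    rw [perimeter_eq]; field_simp; ring
  have hp : 0 < perimeter c := by rw [perimeter_eq]; positivity
  funext i; fin_cases i <;> simp [tri, shape, e] <;> field_simp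

/-- The orientation of the triangle vanishes only on the edges of the triangle of trilinear
coordinates. -/
lemma edge_of_signedArea_eq_zero {c : Config} (hc : Function.Injective c)
    (h : signedArea c = 0) : side c 2 = side c 0 + side c 1 ∨ side c 0 = side c 1 + side c 2 ∨
      side c 1 = side c 2 + side c 0 := by
  have h0 := side_pos hc 0
  have h1 := side_pos hc 1
  have h2 := side_pos hc 2
  have := heron c
  rw [h] at this
  have h3 : 0 < side c 0 + side c 1 + side c 2 := by positivity
  have : (side c 0 + side c 1 - side c 2) = 0 ∨ (side c 1 + side c 2 - side c 0) = 0 ∨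
      (side c 2 + side c 0 - side c 1) = 0 := by
    simpa [h3.ne', or_assoc] using this.symm
  rcases this with h | h | h
  · left; linarith
  · right; left; linarith
  · right; right; linarith

lemma side_lt_of_signedArea_ne_zero {c : Config} (h : signedArea c ≠ 0) :
    side c 0 < side c 1 + side c 2 ∧ side c 1 < side c 2 + side c 0 := by
  have := heron c
  obtain ⟨h0, h1, -⟩ := side_triangle c
  constructor
  · refine lt_of_le_of_ne h0 fun e => h ?_
    rw [e] at this; ring_nf at this; nlinarith
  · refine lt_of_le_of_ne h1 fun e => h ?_
    rw [e] at this; ring_nf at this; nlinarith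

lemma orientation_eq_one_iff {c : Config} : orientation c = 1 ↔ 0 < signedArea c := sign_eq_one_iff

lemma orientation_eq_neg_one_iff {c : Config} : orientation c = -1 ↔ signedArea c < 0 :=
  sign_eq_neg_one_iff

/-! ### The equations of motion in terms of the sides and the area -/

/-- Division by a conjugate is a real rescaling, so each velocity is a real combination of side
vectors, turned by a right angle. -/
lemma div_conj_eq (r : ℝ) (d : ℂ) :
    (r : ℂ) / (starRingEnd ℂ) d = ((r / ‖d‖ ^ 2 : ℝ) : ℂ) * d := by
  rcases eq_or_ne d 0 with rfl | hd
  · simp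
  have h : (starRingEnd ℂ) d ≠ 0 := by simpa using hd
  have hn : ((‖d‖ : ℝ) : ℂ) ^ 2 ≠ 0 := by simpa using hd
  push_cast
  rw [div_mul_eq_mul_div, div_eq_div_iff h hn, mul_assoc, Complex.mul_conj,
    Complex.normSq_eq_norm_sq]
  push_cast; ring

lemma velocity_zero (k : Fin 3 → ℝ) (c : Config) : velocity k c 0 = -Complex.I *
    (((k 1 / side c 2 ^ 2 : ℝ) : ℂ) * (c 1 - c 0) + ((k 2 / side c 1 ^ 2 : ℝ) : ℂ) * (c 2 - c 0)) := by
  have : (Finset.univ.erase (0 : Fin 3)) = {1, 2} := by decide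
  rw [velocity, this, Finset.sum_pair (by decide), ← map_sub, ← map_sub, div_conj_eq, div_conj_eq,
    side_two, side_one, norm_sub_rev (c 1) (c 0)]

lemma velocity_one (k : Fin 3 → ℝ) (c : Config) : velocity k c 1 = -Complex.I *
    (((k 2 / side c 0 ^ 2 : ℝ) : ℂ) * (c 2 - c 1) + ((k 0 / side c 2 ^ 2 : ℝ) : ℂ) * (c 0 - c 1)) := by
  have : (Finset.univ.erase (1 : Fin 3)) = {2, 0} := by decide
  rw [velocity, this, Finset.sum_pair (by decide), ← map_sub, ← map_sub, div_conj_eq, div_conj_eq,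
    side_two, side_zero, norm_sub_rev (c 1) (c 2)]

lemma velocity_two (k : Fin 3 → ℝ) (c : Config) : velocity k c 2 = -Complex.I *
    (((k 0 / side c 1 ^ 2 : ℝ) : ℂ) * (c 0 - c 2) + ((k 1 / side c 0 ^ 2 : ℝ) : ℂ) * (c 1 - c 2)) := by
  have : (Finset.univ.erase (2 : Fin 3)) = {0, 1} := by decide
  rw [velocity, this, Finset.sum_pair (by decide), ← map_sub, ← map_sub, div_conj_eq, div_conj_eq,
    side_one, side_zero, norm_sub_rev (c 2) (c 0)]

section Equations

variable {k : Fin 3 → ℝ} {z : ℝ → Config} {t : ℝ}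

lemma hasDerivAt_re (h : SolvesAt k z t) (j : Fin 3) :
    HasDerivAt (fun s => (z s j).re) (velocity k (z t) j).re t :=
  Complex.reCLM.hasFDerivAt.comp_hasDerivAt t (h.2 j)

lemma hasDerivAt_im (h : SolvesAt k z t) (j : Fin 3) :
    HasDerivAt (fun s => (z s j).im) (velocity k (z t) j).im t :=
  Complex.imCLM.hasFDerivAt.comp_hasDerivAt t (h.2 j)

/-- The mutual velocities of the two end points are perpendicular to the side and drop out; the
third vortex acts on the side through the signed area. -/
lemma hasDerivAt_sq_side (h : SolvesAt k z t) (j : Fin 3) :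
    HasDerivAt (fun s => side (z s) j ^ 2) (4 * signedArea (z t) * k j *
      (1 / side (z t) (j + 1) ^ 2 - 1 / side (z t) (j + 2) ^ 2)) t := by
  have key : ∀ i l : Fin 3, HasDerivAt
      (fun s => ((z s i).re - (z s l).re) ^ 2 + ((z s i).im - (z s l).im) ^ 2) _ t :=
    fun i l => (((hasDerivAt_re h i).sub (hasDerivAt_re h l)).pow 2).add
      (((hasDerivAt_im h i).sub (hasDerivAt_im h l)).pow 2)
  fin_cases j
  · refine ((key 1 2).congr_of_eventuallyEq (.of_forall fun s => sq_side_zero _)).congr_deriv ?_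
    simp [velocity_one, velocity_two, signedArea_eq, Complex.mul_re, Complex.mul_im,
      -Complex.ofReal_div, -Complex.ofReal_pow]
    ring
  · refine ((key 2 0).congr_of_eventuallyEq (.of_forall fun s => sq_side_one _)).congr_deriv ?_
    simp [velocity_zero, velocity_two, signedArea_eq, Complex.mul_re, Complex.mul_im,
      -Complex.ofReal_div, -Complex.ofReal_pow]
    ring
  · refine ((key 0 1).congr_of_eventuallyEq (.of_forall fun s => sq_side_two _)).congr_deriv ?_
    simp [velocity_zero, velocity_one, signedArea_eq, Complex.mul_re, Complex.mul_im,
      -Complex.ofReal_div, -Complex.ofReal_pow]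
    ring

lemma hasDerivAt_log_side (h : SolvesAt k z t) (j : Fin 3) :
    HasDerivAt (fun s => Real.log (side (z s) j)) (2 * signedArea (z t) * k j *
      (1 / side (z t) (j + 1) ^ 2 - 1 / side (z t) (j + 2) ^ 2) / side (z t) j ^ 2) t := by
  have hp := side_pos h.1 j
  have := ((hasDerivAt_sq_side h j).log (by positivity)).const_mul (1 / 2)
  refine (this.congr_of_eventuallyEq (.of_forall fun s => ?_)).congr_deriv ?_
  · simp only [Real.log_pow]; push_cast; ring
  · ring

lemma hasDerivAt_side (h : SolvesAt k z t) (j : Fin 3) :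
    HasDerivAt (fun s => side (z s) j) (2 * signedArea (z t) * k j *
      (1 / side (z t) (j + 1) ^ 2 - 1 / side (z t) (j + 2) ^ 2) / side (z t) j) t := by
  have hp := side_pos h.1 j
  have := (hasDerivAt_sq_side h j).sqrt (by positivity)
  refine (this.congr_of_eventuallyEq (.of_forall fun s => ?_)).congr_deriv ?_
  · exact (Real.sqrt_sq (norm_nonneg _)).symm
  · rw [Real.sqrt_sq hp.le]; field_simp; ring

lemma hasDerivAt_signedArea (h : SolvesAt k z t) :
    HasDerivAt (fun s => signedArea (z s)) (
      ((k 0 + k 1) * (side (z t) 0 ^ 2 - side (z t) 1 ^ 2) / side (z t) 2 ^ 2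
      + (k 1 + k 2) * (side (z t) 1 ^ 2 - side (z t) 2 ^ 2) / side (z t) 0 ^ 2
      + (k 2 + k 0) * (side (z t) 2 ^ 2 - side (z t) 0 ^ 2) / side (z t) 1 ^ 2) / 4) t := by
  have key := (((((hasDerivAt_re h 1).sub (hasDerivAt_re h 0)).mul
    ((hasDerivAt_im h 2).sub (hasDerivAt_im h 0))).sub
    (((hasDerivAt_im h 1).sub (hasDerivAt_im h 0)).mul
    ((hasDerivAt_re h 2).sub (hasDerivAt_re h 0)))).div_const 2)
  refine (key.congr_of_eventuallyEq (.of_forall fun s => signedArea_eq _)).congr_deriv ?_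
  have h0 := (pow_pos (side_pos h.1 0) 2).ne'
  have h1 := (pow_pos (side_pos h.1 1) 2).ne'
  have h2 := (pow_pos (side_pos h.1 2) 2).ne'
  have w0 := mul_inv_cancel₀ h0
  have w1 := mul_inv_cancel₀ h1
  have w2 := mul_inv_cancel₀ h2
  simp only [Pi.sub_apply, velocity_zero, velocity_one, velocity_two, Complex.mul_re, Complex.mul_im,
    Complex.add_re, Complex.add_im, Complex.sub_re, Complex.sub_im, Complex.neg_re, Complex.neg_im,
    Complex.I_re, Complex.I_im, Complex.ofReal_re, Complex.ofReal_im, div_eq_mul_inv]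
  -- With the inverse squares as independent unknowns, the claim is a combination of the three
  -- relations `R² r = 1`.
  generalize (side (z t) 0 ^ 2)⁻¹ = r0 at *
  generalize (side (z t) 1 ^ 2)⁻¹ = r1 at *
  generalize (side (z t) 2 ^ 2)⁻¹ = r2 at *
  rw [sq_side_zero] at w0
  rw [sq_side_one] at w1
  rw [sq_side_two] at w2
  rw [sq_side_zero, sq_side_one, sq_side_two]
  linear_combination (k 2 - k 1) / 4 * w0 + (k 0 - k 2) / 4 * w1 + (k 1 - k 0) / 4 * w2

end Equations

end ThreeVortex

namespace ThreeVortex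

/-! ### Planar systems with a first integral -/

lemma hasDerivAt_comp_neg {E : Type*} [NormedAddCommGroup E] [NormedSpace ℝ E] {f : ℝ → E} {d : E}
    {t : ℝ} (h : HasDerivAt f d (-t)) : HasDerivAt (fun x => f (-x)) (-d) t := by
  have := h.scomp t (hasDerivAt_neg t)
  rwa [neg_one_smul] at this

/-- A convergent function whose derivative converges has derivative tending to zero. -/
lemma eq_zero_of_tendsto_of_deriv_tendsto {f f' : ℝ → ℝ} {l L : ℝ}
    (hd : ∀ t, HasDerivAt f (f' t) t) (hf : Tendsto f atTop (𝓝 l)) (hf' : Tendsto f' atTop (𝓝 L)) :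
    L = 0 := by
  have h : ∀ t : ℝ, ∃ ξ, t < ξ ∧ f' ξ = f (t + 1) - f t := fun t => by
    obtain ⟨ξ, hξ, h⟩ := exists_hasDerivAt_eq_slope f f' (show t < t + 1 by linarith)
      (fun x _ => (hd x).continuousAt.continuousWithinAt) (fun x _ => hd x)
    exact ⟨ξ, hξ.1, by rw [h]; simp⟩
  choose ξ hξ h using h
  have h1 : Tendsto (fun t => f' (ξ t)) atTop (𝓝 L) :=
    hf'.comp (tendsto_atTop_mono (fun t => (hξ t).le) tendsto_id)
  have h2 : Tendsto (fun t => f' (ξ t)) atTop (𝓝 (l - l)) := by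
    simp only [h]
    exact (hf.comp (tendsto_atTop_add_const_right _ 1 tendsto_id)).sub hf
  simpa using tendsto_nhds_unique h1 h2

/-- A bounded function with nonvanishing derivative on a half line converges. -/
lemma exists_tendsto_of_deriv_ne_zero {f f' : ℝ → ℝ} {T B : ℝ}
    (hd : ∀ t, HasDerivAt f (f' t) t) (hT : ∀ t, T ≤ t → f' t ≠ 0) (hB : ∀ t, |f t| ≤ B) :
    ∃ l, Tendsto f atTop (𝓝 l) := by
  -- Clamping the argument at `T` turns monotonicity on the half line into global monotonicity.
  have hev : (fun t => f (max t T)) =ᶠ[atTop] f := by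
    filter_upwards [eventually_ge_atTop T] with t ht
    rw [max_eq_left ht]
  have hc : ContinuousOn f (Ici T) := fun x _ => (hd x).continuousAt.continuousWithinAt
  -- By Darboux's theorem the derivative keeps one sign.
  rcases hasDerivWithinAt_forall_lt_or_forall_gt_of_forall_ne (convex_Ici T)
    (fun x _ => (hd x).hasDerivWithinAt) hT with h | h
  · have hanti : AntitoneOn f (Ici T) := antitoneOn_of_deriv_nonpos (convex_Ici T) hc
      (fun x _ => (hd x).differentiableAt.differentiableWithinAt) fun x hx => by
        rw [(hd x).deriv]; exact (h x (interior_subset hx)).le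
    have : Antitone fun t => f (max t T) := fun x y hxy =>
      hanti (mem_Ici.2 (le_max_right _ _)) (mem_Ici.2 (le_max_right _ _)) (max_le_max_right T hxy)
    have hb : BddBelow (range fun t => f (max t T)) :=
      ⟨-B, by rintro _ ⟨t, rfl⟩; exact (abs_le.1 (hB _)).1⟩
    exact ⟨_, (tendsto_atTop_ciInf this hb).congr' hev⟩
  · have hmono : MonotoneOn f (Ici T) := monotoneOn_of_deriv_nonneg (convex_Ici T) hc
      (fun x _ => (hd x).differentiableAt.differentiableWithinAt) fun x hx => by
        rw [(hd x).deriv]; exact (h x (interior_subset hx)).le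
    have : Monotone fun t => f (max t T) := fun x y hxy =>
      hmono (mem_Ici.2 (le_max_right _ _)) (mem_Ici.2 (le_max_right _ _)) (max_le_max_right T hxy)
    have hb : BddAbove (range fun t => f (max t T)) :=
      ⟨B, by rintro _ ⟨t, rfl⟩; exact (abs_le.1 (hB _)).2⟩
    exact ⟨_, (tendsto_atTop_ciSup this hb).congr' hev⟩

/-- A function that is decreasing at each of its zeros is negative after a zero. -/
lemma neg_of_deriv_neg_at_zeros {f f' : ℝ → ℝ} (hd : ∀ t, HasDerivAt f (f' t) t)
    (h0 : ∀ t, f t = 0 → f' t < 0) {t₀ t : ℝ} (ht₀ : f t₀ = 0) (ht : t₀ < t) : f t < 0 := by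
  have hle : ∀ x, t₀ ≤ x → f x ≤ 0 := fun x hx =>
    image_le_of_deriv_right_lt_deriv_boundary (f := f) (f' := f') (a := t₀) (b := x)
      (B := fun _ => 0) (B' := fun _ => 0) (fun y _ => (hd y).continuousAt.continuousWithinAt)
      (fun y _ => (hd y).hasDerivWithinAt) ht₀.le (fun y => hasDerivAt_const y 0)
      (fun y _ hy => h0 y hy) ⟨hx, le_rfl⟩
  refine lt_of_le_of_ne (hle t ht.le) fun h => ?_
  -- A return to zero would be a local maximum, at which the derivative cannot be negative.
  have hmax : IsLocalMax f t := by
    filter_upwards [lt_mem_nhds ht] with x hx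
    rw [h]; exact hle x hx.le
  have := hmax.hasDerivAt_eq_zero (hd t)
  linarith [h0 t h]

lemma pos_of_deriv_neg_at_zeros {f f' : ℝ → ℝ} (hd : ∀ t, HasDerivAt f (f' t) t)
    (h0 : ∀ t, f t = 0 → f' t < 0) {t₀ t : ℝ} (ht₀ : f t₀ = 0) (ht : t < t₀) : 0 < f t := by
  have := neg_of_deriv_neg_at_zeros (f := fun x => -f (-x)) (f' := fun x => f' (-x))
    (fun x => ((hasDerivAt_comp_neg (hd (-x))).neg).congr_deriv (neg_neg _)) (t₀ := -t₀) (t := -t)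
    (fun x hx => h0 _ (by simpa using hx)) (by simpa using ht₀) (by linarith)
  simpa using this

/-- A bounded motion of a planar system `s' = -κ(s) A`, `A' = μ(s)` with the integral `A² = Φ(s)`,
whose only singularities are the zeros of `e` and whose only equilibria are on these. -/
structure PlanarFlow (κ μ Φ e s A : ℝ → ℝ) : Prop where
  hasDerivAt_s : ∀ t, HasDerivAt s (-(κ (s t) * A t)) t
  hasDerivAt_A : ∀ t, HasDerivAt A (μ (s t)) t
  sq_A : ∀ t, A t ^ 2 = Φ (s t)
  bounded : ∃ B, ∀ t, |s t| ≤ B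
  e_ne_zero : ∀ t, e (s t) ≠ 0
  cont_κ : ∀ l, e l ≠ 0 → ContinuousAt κ l
  cont_μ : ∀ l, e l ≠ 0 → ContinuousAt μ l
  cont_Φ : ∀ l, e l ≠ 0 → ContinuousAt Φ l
  κ_ne_zero : ∀ l, e l ≠ 0 → κ l ≠ 0
  μ_ne_zero : ∀ l, e l ≠ 0 → Φ l = 0 → μ l ≠ 0

namespace PlanarFlow

variable {κ μ Φ e s A : ℝ → ℝ}

/-- The system is invariant under reversal of time together with the sign of `A`; this transfers
limits from `+∞` to `-∞`. -/
lemma reverse (h : PlanarFlow κ μ Φ e s A) :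
    PlanarFlow κ μ Φ e (fun t => s (-t)) (fun t => -A (-t)) where
  hasDerivAt_s t := (hasDerivAt_comp_neg (h.hasDerivAt_s (-t))).congr_deriv (by ring)
  hasDerivAt_A t := ((hasDerivAt_comp_neg (h.hasDerivAt_A (-t))).neg).congr_deriv (neg_neg _)
  sq_A t := by simpa using h.sq_A (-t)
  bounded := h.bounded.imp fun B hB t => hB (-t)
  e_ne_zero t := h.e_ne_zero (-t)
  cont_κ := h.cont_κ
  cont_μ := h.cont_μ
  cont_Φ := h.cont_Φ
  κ_ne_zero := h.κ_ne_zero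
  μ_ne_zero := h.μ_ne_zero

/-- Reflection turns upward crossings of `A` into the downward ones that `exists_crossing` assumes.
-/
lemma neg (h : PlanarFlow κ μ Φ e s A) :
    PlanarFlow (fun x => -κ x) (fun x => -μ x) Φ e s (fun t => -A t) where
  hasDerivAt_s t := by simpa using h.hasDerivAt_s t
  hasDerivAt_A t := (h.hasDerivAt_A t).neg
  sq_A t := by simpa using h.sq_A t
  bounded := h.bounded
  e_ne_zero := h.e_ne_zero
  cont_κ l hl := (h.cont_κ l hl).neg
  cont_μ l hl := (h.cont_μ l hl).neg
  cont_Φ := h.cont_Φ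
  κ_ne_zero l hl := neg_ne_zero.2 (h.κ_ne_zero l hl)
  μ_ne_zero l hl h0 := neg_ne_zero.2 (h.μ_ne_zero l hl h0)

lemma deriv_ne_zero (h : PlanarFlow κ μ Φ e s A) {t : ℝ} (ht : A t ≠ 0) :
    -(κ (s t) * A t) ≠ 0 :=
  neg_ne_zero.2 (mul_ne_zero (h.κ_ne_zero _ (h.e_ne_zero t)) ht)

/-- A motion which does not reach the turning points any more tends to a zero of `e`. -/
lemma exists_tendsto_atTop (h : PlanarFlow κ μ Φ e s A) {T : ℝ} (hT : ∀ t, T ≤ t → A t ≠ 0) :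
    ∃ l, Tendsto s atTop (𝓝 l) ∧ e l = 0 := by
  obtain ⟨B, hB⟩ := h.bounded
  obtain ⟨l, hl⟩ := exists_tendsto_of_deriv_ne_zero h.hasDerivAt_s
    (fun t ht => h.deriv_ne_zero (hT t ht)) hB
  refine ⟨l, hl, by_contra fun he => ?_⟩
  -- At a regular limit `A²` converges, and `A` has constant sign, so `A` converges too.
  have hΦ : Tendsto (fun t => A t ^ 2) atTop (𝓝 (Φ l)) := by
    simp only [h.sq_A]; exact (h.cont_Φ l he).tendsto.comp hl
  have habs : Tendsto (fun t => |A t|) atTop (𝓝 √(Φ l)) := by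
    simpa only [Real.sqrt_sq_eq_abs] using hΦ.sqrt
  have hA : ∃ α, Tendsto A atTop (𝓝 α) ∧ α ^ 2 = Φ l := by
    have hα : ∃ α, Tendsto A atTop (𝓝 α) := by
      rcases lt_or_gt_of_ne (hT T le_rfl) with h1 | h1
      · refine ⟨-√(Φ l), habs.neg.congr' ?_⟩
        filter_upwards [eventually_ge_atTop T] with t ht
        rw [abs_of_neg, neg_neg]
        by_contra! hge
        obtain ⟨x, hx, hx0⟩ := intermediate_value_Icc ht
          (fun x _ => (h.hasDerivAt_A x).continuousAt.continuousWithinAt) ⟨h1.le, hge⟩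
        exact hT x hx.1 hx0
      · refine ⟨√(Φ l), habs.congr' ?_⟩
        filter_upwards [eventually_ge_atTop T] with t ht
        rw [abs_of_pos]
        by_contra! hge
        obtain ⟨x, hx, hx0⟩ := intermediate_value_Icc' ht
          (fun x _ => (h.hasDerivAt_A x).continuousAt.continuousWithinAt) ⟨hge, h1.le⟩
        exact hT x hx.1 hx0
    obtain ⟨α, hα⟩ := hα
    exact ⟨α, hα, tendsto_nhds_unique (hα.pow 2) hΦ⟩
  obtain ⟨α, hα, hα2⟩ := hA
  -- Both derivatives converge, hence to zero: the limit would be an equilibrium with `Φ l = α² = 0`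
  -- and `μ l = 0`, which is excluded.
  have hs' : -(κ l * α) = 0 := eq_zero_of_tendsto_of_deriv_tendsto h.hasDerivAt_s hl
    ((((h.cont_κ l he).tendsto.comp hl).mul hα).neg)
  have hμ : μ l = 0 := eq_zero_of_tendsto_of_deriv_tendsto h.hasDerivAt_A hα
    ((h.cont_μ l he).tendsto.comp hl)
  have : α = 0 := by simpa [h.κ_ne_zero l he] using hs'
  exact h.μ_ne_zero l he (by rw [← hα2, this]; simp) hμ

lemma exists_tendsto_atBot (h : PlanarFlow κ μ Φ e s A) {T : ℝ} (hT : ∀ t, t ≤ T → A t ≠ 0) :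
    ∃ l, Tendsto s atBot (𝓝 l) ∧ e l = 0 := by
  obtain ⟨l, hl, he⟩ := h.reverse.exists_tendsto_atTop (T := -T)
    (fun t ht => neg_ne_zero.2 (hT (-t) (by linarith)))
  refine ⟨l, ?_, he⟩
  simpa [Function.comp_def] using hl.comp tendsto_neg_atBot_atTop

/-- A motion without turning points, the coordinate `s` decreasing. -/
lemma strictAnti (h : PlanarFlow κ μ Φ e s A) (hA : ∀ t, 0 < κ (s t) * A t) : StrictAnti s :=
  strictAnti_of_deriv_neg fun t => by rw [(h.hasDerivAt_s t).deriv]; linarith [hA t]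

/-- A motion without turning points, the coordinate `s` increasing. -/
lemma strictMono (h : PlanarFlow κ μ Φ e s A) (hA : ∀ t, κ (s t) * A t < 0) : StrictMono s :=
  strictMono_of_deriv_pos fun t => by rw [(h.hasDerivAt_s t).deriv]; linarith [hA t]

/-- A motion which starts and ends at the same point has exactly one turning point. -/
lemma exists_crossing (h : PlanarFlow κ μ Φ e s A) (l₀ : ℝ)
    (hl : ∀ l, (Tendsto s atTop (𝓝 l) ∨ Tendsto s atBot (𝓝 l)) → e l = 0 → l = l₀)
    (hμ : ∀ t, A t = 0 → μ (s t) < 0) :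
    ∃ t₀, A t₀ = 0 ∧ (∀ t < t₀, 0 < A t) ∧ (∀ t > t₀, A t < 0) ∧
      Tendsto s atTop (𝓝 l₀) ∧ Tendsto s atBot (𝓝 l₀) := by
  have hz : ∃ t₀, A t₀ = 0 := by
    -- Without a turning point `s` is strictly monotone, yet has the same limit `l₀` at both ends of
    -- time.
    by_contra! hne
    obtain ⟨l, h1, he1⟩ := h.exists_tendsto_atTop (T := 0) fun t _ => hne t
    obtain ⟨l', h2, he2⟩ := h.exists_tendsto_atBot (T := 0) fun t _ => hne t
    obtain rfl := hl l (.inl h1) he1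
    obtain rfl := hl l' (.inr h2) he2
    rcases hasDerivWithinAt_forall_lt_or_forall_gt_of_forall_ne convex_univ
      (fun x _ => (h.hasDerivAt_s x).hasDerivWithinAt) fun x _ => h.deriv_ne_zero (hne x) with h3 | h3
    · have ha : StrictAnti s :=
        strictAnti_of_deriv_neg fun t => by rw [(h.hasDerivAt_s t).deriv]; exact h3 t trivial
      have := ha.antitone.le_of_tendsto h1 1
      have := ha.antitone.ge_of_tendsto h2 0
      have := ha zero_lt_one
      linarith
    · have ha : StrictMono s :=
        strictMono_of_deriv_pos fun t => by rw [(h.hasDerivAt_s t).deriv]; exact h3 t trivial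
      have := ha.monotone.ge_of_tendsto h1 1
      have := ha.monotone.le_of_tendsto h2 0
      have := ha zero_lt_one
      linarith
  obtain ⟨t₀, ht₀⟩ := hz
  have hn := fun t => neg_of_deriv_neg_at_zeros h.hasDerivAt_A hμ ht₀ (t := t)
  have hp := fun t => pos_of_deriv_neg_at_zeros h.hasDerivAt_A hμ ht₀ (t := t)
  refine ⟨t₀, ht₀, hp, hn, ?_, ?_⟩
  · obtain ⟨l, h1, he1⟩ := h.exists_tendsto_atTop (T := t₀ + 1) fun t ht =>
      (hn t (by linarith)).ne
    rwa [← hl l (.inl h1) he1]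
  · obtain ⟨l, h1, he1⟩ := h.exists_tendsto_atBot (T := t₀ - 1) fun t ht =>
      (hp t (by linarith)).ne'
    rwa [← hl l (.inr h1) he1]

end PlanarFlow

end ThreeVortex

namespace ThreeVortex

/-! ### Conserved quantities -/

/-- The normalised logarithm of the invariant of a configuration. -/
noncomputable def level (a b : ℝ) (c : Config) : ℝ :=
  a * Real.log (side c 0) + b * Real.log (side c 1) - Real.log (side c 2)

/-- The normalised angular impulse of a configuration about its centre. -/
noncomputable def moment (a b : ℝ) (c : Config) : ℝ :=
  side c 2 ^ 2 - a * side c 0 ^ 2 - b * side c 1 ^ 2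

/-- The coordinate on a level curve. -/
noncomputable def logRatio (c : Config) : ℝ := Real.log (side c 1) - Real.log (side c 0)

/-- The normalised rate of change of the signed area. -/
noncomputable def areaRate (K a b u v : ℝ) : ℝ :=
  K / 4 * (u ^ 2 - v ^ 2 + a ^ 2 * (v ^ 2 - 1) / u ^ 2 + b ^ 2 * (1 - u ^ 2) / v ^ 2)

lemma scaledStrength_zero (K a b : ℝ) : scaledStrength K a b 0 = b * K := rfl
lemma scaledStrength_one (K a b : ℝ) : scaledStrength K a b 1 = a * K := rfl
lemma scaledStrength_two (K a b : ℝ) : scaledStrength K a b 2 = -(a * b * K) := rfl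

section

variable {a b : ℝ} (ha : 0 < a) (hb : 0 < b) (hab : a + b = 1) {K : ℝ} (hK : 0 < K)

include hab in
lemma level_eq {c : Config} (hc : Function.Injective c) :
    level a b c = logLevel a b (side c 0 / side c 2) (side c 1 / side c 2) := by
  rw [logLevel, Real.log_div (side_pos hc 0).ne' (side_pos hc 2).ne',
    Real.log_div (side_pos hc 1).ne' (side_pos hc 2).ne', level]
  linear_combination Real.log (side c 2) * hab

lemma moment_eq {c : Config} (hc : Function.Injective c) :
    moment a b c = side c 2 ^ 2 * ellipse a b (side c 0 / side c 2) (side c 1 / side c 2) := by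
  have := side_pos hc 2
  unfold moment ellipse; field_simp

include hab in
-- Solve `a log u + b log v = l`, `log v - log u = s` for `log u`, using `a + b = 1`; this
-- parametrises the level curve by `s`.
lemma ratio_zero_eq {c : Config} (hc : Function.Injective c) :
    side c 0 / side c 2 = Real.exp (level a b c - b * logRatio c) := by
  rw [← Real.exp_log (div_pos (side_pos hc 0) (side_pos hc 2)),
    Real.log_div (side_pos hc 0).ne' (side_pos hc 2).ne', level, logRatio]
  congr 1; linear_combination (- Real.log (side c 0)) * hab

include hab in
lemma ratio_one_eq {c : Config} (hc : Function.Injective c) :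
    side c 1 / side c 2 = Real.exp (level a b c + a * logRatio c) := by
  rw [← Real.exp_log (div_pos (side_pos hc 1) (side_pos hc 2)),
    Real.log_div (side_pos hc 1).ne' (side_pos hc 2).ne', level, logRatio]
  congr 1; linear_combination (- Real.log (side c 1)) * hab

include hab in
lemma logLevel_exp (l s : ℝ) :
    logLevel a b (Real.exp (l - b * s)) (Real.exp (l + a * s)) = l := by
  rw [logLevel, Real.log_exp, Real.log_exp]; linear_combination l * hab

include hab in
lemma exp_lt_exp_iff_pos (l s : ℝ) :
    Real.exp (l - b * s) < Real.exp (l + a * s) ↔ 0 < s := by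
  rw [Real.exp_lt_exp]
  constructor
  · intro h
    have : 0 < (a + b) * s := by linarith
    rwa [hab, one_mul] at this
  · intro h
    have : 0 < (a + b) * s := by rwa [hab, one_mul]
    linarith

include hab in
lemma exp_lt_exp_iff_neg (l s : ℝ) :
    Real.exp (l + a * s) < Real.exp (l - b * s) ↔ s < 0 := by
  have := exp_lt_exp_iff_pos (a := b) (b := a) (by linarith) l (-s)
  simpa [← sub_eq_add_neg] using this

include hab in
lemma tri_eq {c : Config} (hc : Function.Injective c) : tri c =
    shape (Real.exp (level a b c - b * logRatio c)) (Real.exp (level a b c + a * logRatio c)) := by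
  rw [tri_eq_shape hc, ratio_zero_eq hab hc, ratio_one_eq hab hc]

include hab in
lemma invI_tri {c : Config} (hc : Function.Injective c) :
    invI (scaledStrength K a b) (tri c) = Real.exp (K * level a b c) := by
  rw [tri_eq hab hc, invI_shape (Real.exp_pos _) (Real.exp_pos _), logLevel_exp hab]

lemma formY_tri {c : Config} (hc : Function.Injective c) :
    formY (scaledStrength K a b) (tri c) = a * b * K ^ 2 / perimeter c ^ 2 * moment a b c := by
  have h0 := side_pos hc 0
  have h1 := side_pos hc 1
  have h2 := side_pos hc 2
  have hp : 0 < perimeter c := by rw [perimeter_eq]; positivity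
  have e : 1 + side c 0 / side c 2 + side c 1 / side c 2 = perimeter c / side c 2 := by
    rw [perimeter_eq]; field_simp; ring
  rw [tri_eq_shape hc, formY_shape (div_pos h0 h2) (div_pos h1 h2), e, moment_eq hc]
  field_simp

lemma perimeter_pos {c : Config} (hc : Function.Injective c) : 0 < perimeter c := by
  have h0 := side_pos hc 0
  have h1 := side_pos hc 1
  have h2 := side_pos hc 2
  rw [perimeter_eq]; positivity

include ha hb hK in
lemma formY_tri_pos {c : Config} (hc : Function.Injective c) :
    0 < formY (scaledStrength K a b) (tri c) ↔ 0 < moment a b c := by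
  have := perimeter_pos hc
  rw [formY_tri hc, mul_pos_iff_of_pos_left (by positivity)]

include ha hb hK in
lemma formY_tri_neg {c : Config} (hc : Function.Injective c) :
    formY (scaledStrength K a b) (tri c) < 0 ↔ moment a b c < 0 := by
  have := perimeter_pos hc
  rw [formY_tri hc, ← neg_pos, ← mul_neg, mul_pos_iff_of_pos_left (by positivity), neg_pos]

include hab in
lemma tri_zero_lt_one {c : Config} (hc : Function.Injective c) :
    tri c 0 < tri c 1 ↔ 0 < logRatio c := by
  rw [tri_eq hab hc, shape_lt_iff (Real.exp_pos _) (Real.exp_pos _), exp_lt_exp_iff_pos hab]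

include hab in
lemma tri_one_lt_zero {c : Config} (hc : Function.Injective c) :
    tri c 1 < tri c 0 ↔ logRatio c < 0 := by
  rw [tri_eq hab hc, shape_lt_iff' (Real.exp_pos _) (Real.exp_pos _), exp_lt_exp_iff_neg hab]

variable {z : ℝ → Config} {t : ℝ}

/-- The products `a k₁`, `b k₂` and `-k₃` all equal `abK`, so the logarithmic rates form a cyclic
sum that cancels. -/
lemma hasDerivAt_level (h : SolvesAt (scaledStrength K a b) z t) :
    HasDerivAt (fun s => level a b (z s)) 0 t := by
  have h0 := (side_pos h.1 0).ne'
  have h1 := (side_pos h.1 1).ne'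
  have h2 := (side_pos h.1 2).ne'
  refine ((((hasDerivAt_log_side h 0).const_mul a).add
    ((hasDerivAt_log_side h 1).const_mul b)).sub (hasDerivAt_log_side h 2)).congr_deriv ?_
  simp only [scaledStrength_zero, scaledStrength_one, scaledStrength_two, zero_add,
    show (1 : Fin 3) + 1 = 2 from rfl, show (1 : Fin 3) + 2 = 0 from rfl,
    show (2 : Fin 3) + 1 = 0 from rfl, show (2 : Fin 3) + 2 = 1 from rfl]
  field_simp
  ring

/-- The same equality of products makes the rates of the squared sides telescope. -/
lemma hasDerivAt_moment (h : SolvesAt (scaledStrength K a b) z t) :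
    HasDerivAt (fun s => moment a b (z s)) 0 t := by
  refine (((hasDerivAt_sq_side h 2).sub ((hasDerivAt_sq_side h 0).const_mul a)).sub
    ((hasDerivAt_sq_side h 1).const_mul b)).congr_deriv ?_
  simp only [scaledStrength_zero, scaledStrength_one, scaledStrength_two, zero_add,
    show (1 : Fin 3) + 1 = 2 from rfl, show (1 : Fin 3) + 2 = 0 from rfl,
    show (2 : Fin 3) + 1 = 0 from rfl, show (2 : Fin 3) + 2 = 1 from rfl]
  ring

/-- For `a + b = 1` the bracket is the conserved impulse, so off the critical curve `s` is
stationary only at collinear shapes. -/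
lemma hasDerivAt_logRatio (h : SolvesAt (scaledStrength K a b) z t) :
    HasDerivAt (fun s => logRatio (z s)) (-(2 * K * ((a + b) * side (z t) 2 ^ 2 - a * side (z t) 0 ^ 2
      - b * side (z t) 1 ^ 2) * signedArea (z t) /
      (side (z t) 0 ^ 2 * side (z t) 1 ^ 2 * side (z t) 2 ^ 2))) t := by
  have h0 := (side_pos h.1 0).ne'
  have h1 := (side_pos h.1 1).ne'
  have h2 := (side_pos h.1 2).ne'
  refine ((hasDerivAt_log_side h 1).sub (hasDerivAt_log_side h 0)).congr_deriv ?_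
  simp only [scaledStrength_zero, scaledStrength_one, zero_add,
    show (1 : Fin 3) + 1 = 2 from rfl, show (1 : Fin 3) + 2 = 0 from rfl]
  field_simp
  ring

include hab in
lemma hasDerivAt_signedArea' (h : SolvesAt (scaledStrength K a b) z t) :
    HasDerivAt (fun s => signedArea (z s)) (areaRate K a b (side (z t) 0 / side (z t) 2)
      (side (z t) 1 / side (z t) 2)) t := by
  have h0 := (side_pos h.1 0).ne'
  have h1 := (side_pos h.1 1).ne'
  have h2 := (side_pos h.1 2).ne'
  refine (hasDerivAt_signedArea h).congr_deriv ?_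
  simp only [scaledStrength_zero, scaledStrength_one, scaledStrength_two, areaRate]
  obtain rfl : b = 1 - a := by linarith
  field_simp
  ring

include hab in
-- The factor before the form is positive when `K` and `a` are, so the direction in which a motion
-- crosses this edge depends only on the side of the critical curve. On the edge `u = 1 + v` the
-- sign is opposite.
lemma areaRate_edge_one {u : ℝ} (hu : 0 < u) : areaRate K a b u (1 + u)
    = K / 2 * (a + u) / (u * (1 + u)) * ellipse a b u (1 + u) := by
  unfold areaRate ellipse
  obtain rfl : b = 1 - a := by linarith
  field_simp
  ring

include hab in
lemma areaRate_edge_zero {v : ℝ} (hv : 0 < v) : areaRate K a b (1 + v) v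
    = -(K / 2 * (b + v) / (v * (1 + v)) * ellipse a b (1 + v) v) := by
  unfold areaRate ellipse
  obtain rfl : b = 1 - a := by linarith
  field_simp
  ring

/-! ### A priori bounds -/

include ha hb hab in
-- A negative level forces one ratio below 1; the triangle inequality then keeps the other below 2.
lemma ratio_lt_two {c : Config} (hc : Function.Injective c) (hl : level a b c < 0) :
    side c 0 / side c 2 < 2 ∧ side c 1 / side c 2 < 2 := by
  have h0 := side_pos hc 0
  have h1 := side_pos hc 1
  have h2 := side_pos hc 2
  obtain ⟨t0, t1, -⟩ := side_triangle c
  rw [level_eq hab hc] at hl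
  have hor : side c 0 / side c 2 < 1 ∨ side c 1 / side c 2 < 1 := by
    by_contra! h
    have := logLevel_le_of_le ha hb one_pos one_pos h.1 h.2
    rw [logLevel_one_one] at this
    linarith
  simp only [div_lt_iff₀ h2] at hor ⊢
  rcases hor with h | h <;> constructor <;> linarith

include ha hb hab in
/-- Lower bounds for the ratios of the sides. -/
lemma le_log_ratio {c : Config} (hc : Function.Injective c) (hl : level a b c < 0) :
    (level a b c - b * Real.log 2) / a ≤ Real.log (side c 0 / side c 2) ∧
    (level a b c - a * Real.log 2) / b ≤ Real.log (side c 1 / side c 2) := by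
  obtain ⟨hu, hv⟩ := ratio_lt_two ha hb hab hc hl
  have h1 := mul_lt_mul_of_pos_left
    (Real.log_lt_log (div_pos (side_pos hc 0) (side_pos hc 2)) hu) ha
  have h2 := mul_lt_mul_of_pos_left
    (Real.log_lt_log (div_pos (side_pos hc 1) (side_pos hc 2)) hv) hb
  rw [level_eq hab hc, div_le_iff₀ ha, div_le_iff₀ hb]
  unfold logLevel
  constructor <;> linarith

include ha hb hab in
lemma exists_logRatio_bound {l : ℝ} (hl : l < 0) : ∃ B, ∀ c : Config, Function.Injective c →
    level a b c = l → |logRatio c| ≤ B := by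
  refine ⟨max (Real.log 2 - (l - b * Real.log 2) / a) (Real.log 2 - (l - a * Real.log 2) / b),
    fun c hc hcl => ?_⟩
  have h0 := side_pos hc 0
  have h1 := side_pos hc 1
  have h2 := side_pos hc 2
  obtain ⟨hu, hv⟩ := ratio_lt_two ha hb hab hc (hcl.trans_lt hl)
  obtain ⟨hu', hv'⟩ := le_log_ratio ha hb hab hc (hcl.trans_lt hl)
  have hu2 := Real.log_lt_log (div_pos h0 h2) hu
  have hv2 := Real.log_lt_log (div_pos h1 h2) hv
  rw [hcl] at hu' hv'
  have e : logRatio c = Real.log (side c 1 / side c 2) - Real.log (side c 0 / side c 2) := by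
    rw [Real.log_div h1.ne' h2.ne', Real.log_div h0.ne' h2.ne', logRatio]; ring
  rw [abs_le', e]
  exact ⟨le_max_of_le_left (by linarith), le_max_of_le_right (by linarith)⟩

include ha hb hab in
/-- The vortices stay apart. -/
lemma exists_side_bound {l M : ℝ} (hl : l < 0) (hM : M ≠ 0) : ∃ δ > 0, ∀ c : Config,
    Function.Injective c → level a b c = l → moment a b c = M → ∀ j, δ ≤ side c j := by
  set m₀ := Real.exp ((l - b * Real.log 2) / a)
  set m₁ := Real.exp ((l - a * Real.log 2) / b)
  -- For `u, v < 2` the form has absolute value at most 4, so `M = R₃² · ellipse` gives `R₃ ≥ √|M| /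
  -- 2`.
  set r := √|M| / 2
  have hr : 0 < r := by have := abs_pos.2 hM; positivity
  have hm₀ : 0 < m₀ := Real.exp_pos _
  have hm₁ : 0 < m₁ := Real.exp_pos _
  refine ⟨min r (min (m₀ * r) (m₁ * r)), by positivity, fun c hc hcl hcM => ?_⟩
  have h0 := side_pos hc 0
  have h1 := side_pos hc 1
  have h2 := side_pos hc 2
  obtain ⟨hu, hv⟩ := ratio_lt_two ha hb hab hc (hcl.trans_lt hl)
  obtain ⟨hu', hv'⟩ := le_log_ratio ha hb hab hc (hcl.trans_lt hl)
  rw [hcl, Real.le_log_iff_exp_le (div_pos h0 h2)] at hu'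
  rw [hcl, Real.le_log_iff_exp_le (div_pos h1 h2)] at hv'
  have h3 : r ≤ side c 2 := by
    rw [div_le_iff₀ two_pos, Real.sqrt_le_left (by positivity), ← hcM, moment_eq hc, abs_mul,
      abs_of_pos (by positivity), mul_pow]
    refine mul_le_mul_of_nonneg_left ?_ (by positivity)
    have p0 := div_pos h0 h2
    have p1 := div_pos h1 h2
    generalize side c 0 / side c 2 = u at *
    generalize side c 1 / side c 2 = v at *
    have hu4 : u ^ 2 ≤ 4 := by nlinarith
    have hv4 : v ^ 2 ≤ 4 := by nlinarith
    rw [abs_le', ellipse]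
    constructor <;> nlinarith [sq_nonneg u, sq_nonneg v]
  rw [le_div_iff₀ h2] at hu' hv'
  intro j
  fin_cases j
  · refine (min_le_right _ _).trans ((min_le_left _ _).trans (le_trans ?_ hu'))
    exact mul_le_mul_of_nonneg_left h3 hm₀.le
  · refine (min_le_right _ _).trans ((min_le_right _ _).trans (le_trans ?_ hv'))
    exact mul_le_mul_of_nonneg_left h3 hm₁.le
  · exact (min_le_left _ _).trans h3

/-! ### The motion on a level curve as a planar system -/

include ha hb hab hK in
/-- The motion on a level curve with the coordinate `logRatio` and the signed area. -/
lemma planarFlow_of_isMotion {l M : ℝ} (hz : IsMotion (scaledStrength K a b) z)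
    (hl : endLevel a b < l) (hl0 : l < 0) (hM : M ≠ 0)
    (hzl : ∀ t, level a b (z t) = l) (hzM : ∀ t, moment a b (z t) = M) :
    PlanarFlow
      (fun s => 2 * K * ellipse a b (Real.exp (l - b * s)) (Real.exp (l + a * s)) ^ 3
        / (M ^ 2 * Real.exp (l - b * s) ^ 2 * Real.exp (l + a * s) ^ 2))
      (fun s => areaRate K a b (Real.exp (l - b * s)) (Real.exp (l + a * s)))
      (fun s => (M / ellipse a b (Real.exp (l - b * s)) (Real.exp (l + a * s))) ^ 2 *
        ((1 + Real.exp (l - b * s) + Real.exp (l + a * s)) *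
        ((Real.exp (l - b * s) + Real.exp (l + a * s) - 1) *
          (Real.exp (l + a * s) + 1 - Real.exp (l - b * s)) *
          (1 + Real.exp (l - b * s) - Real.exp (l + a * s)))) / 16)
      (fun s => ellipse a b (Real.exp (l - b * s)) (Real.exp (l + a * s)))
      (fun t => logRatio (z t)) (fun t => signedArea (z t)) := by
  have hu : ∀ t, Real.exp (l - b * logRatio (z t)) = side (z t) 0 / side (z t) 2 := fun t => by
    rw [ratio_zero_eq hab (hz t).1, hzl]
  have hv : ∀ t, Real.exp (l + a * logRatio (z t)) = side (z t) 1 / side (z t) 2 := fun t => by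
    rw [ratio_one_eq hab (hz t).1, hzl]
  -- As `M ≠ 0`, this expresses `R₃²` as `M / ellipse` and eliminates the size from all three
  -- equations.
  have he : ∀ t, side (z t) 2 ^ 2 *
      ellipse a b (side (z t) 0 / side (z t) 2) (side (z t) 1 / side (z t) 2) = M := fun t => by
    rw [← moment_eq (hz t).1, hzM]
  have he0 : ∀ t, ellipse a b (side (z t) 0 / side (z t) 2) (side (z t) 1 / side (z t) 2) ≠ 0 :=
    fun t h => hM (by rw [← he t, h, mul_zero])
  have cE : Continuous fun s => ellipse a b (Real.exp (l - b * s)) (Real.exp (l + a * s)) := by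
    unfold ellipse; fun_prop
  refine ⟨fun t => ?_, fun t => ?_, fun t => ?_, ?_, fun t => ?_, fun s hs => ?_, fun s _ => ?_,
    fun s hs => ?_, fun s hs => ?_, fun s hs h => ?_⟩
  · refine (hasDerivAt_logRatio (hz t)).congr_deriv ?_
    have h0 := side_pos (hz t).1 0
    have h1 := side_pos (hz t).1 1
    have h2 := side_pos (hz t).1 2
    have hm : (a + b) * side (z t) 2 ^ 2 - a * side (z t) 0 ^ 2 - b * side (z t) 1 ^ 2 = M := by
      rw [hab, one_mul, ← hzM t, moment]
    simp only [hu, hv]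
    rw [hm]
    have he1 : ellipse a b (side (z t) 0 / side (z t) 2) (side (z t) 1 / side (z t) 2)
      = M / side (z t) 2 ^ 2 := by rw [← he t]; field_simp
    rw [he1]
    field_simp
  · simp only [hu, hv]; exact hasDerivAt_signedArea' hab (hz t)
  · simp only [hu, hv]
    have h2 := side_pos (hz t).1 2
    have := heron (z t)
    have he1 : M / ellipse a b (side (z t) 0 / side (z t) 2) (side (z t) 1 / side (z t) 2)
      = side (z t) 2 ^ 2 := by rw [← he t, mul_div_cancel_right₀ _ (he0 t)]
    rw [he1]
    field_simp
    linear_combination this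
  · obtain ⟨B, hB⟩ := exists_logRatio_bound ha hb hab hl0
    exact ⟨B, fun t => hB _ (hz t).1 (hzl t)⟩
  · simp only [hu, hv]; exact he0 t
  · refine ContinuousAt.div ?_ ?_ (by positivity)
    · exact (continuous_const.mul (cE.pow 3)).continuousAt
    · fun_prop
  · unfold areaRate
    have : ∀ x, Real.exp x ^ 2 ≠ 0 := fun x => by positivity
    fun_prop (disch := exact this _)
  · refine ContinuousAt.div_const (ContinuousAt.mul ((ContinuousAt.div continuousAt_const
      cE.continuousAt hs).pow 2) ?_) _
    fun_prop
  · have := pow_ne_zero 3 hs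
    positivity
  · have hlev := logLevel_exp hab l s
    have pu := Real.exp_pos (l - b * s)
    have pv := Real.exp_pos (l + a * s)
    generalize Real.exp (l - b * s) = u at *
    generalize Real.exp (l + a * s) = v at *
    -- The level rules out the edge `x₃ = 1/2`; on the other two the area rate is a nonzero multiple
    -- of the form.
    have h3 : u + v ≠ 1 := add_ne_one ha hb hab pu pv (by rwa [hlev])
    have h4 : (v + 1 - u) * (1 + u - v) = 0 := by
      have : (M / ellipse a b u v) ^ 2 ≠ 0 := pow_ne_zero _ (div_ne_zero hM hs)
      have h5 : 1 + u + v ≠ 0 := by positivity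
      have h6 : u + v - 1 ≠ 0 := sub_ne_zero.2 h3
      simpa [hM, hs, h5, h6] using h
    rcases mul_eq_zero.1 h4 with h | h
    · obtain rfl : u = 1 + v := by linarith
      rw [areaRate_edge_zero hab pv]
      have : 0 < K / 2 * (b + v) / (v * (1 + v)) := by positivity
      exact neg_ne_zero.2 (mul_ne_zero this.ne' hs)
    · obtain rfl : v = 1 + u := by linarith
      rw [areaRate_edge_one hab pu]
      have : 0 < K / 2 * (a + u) / (u * (1 + u)) := by positivity
      exact mul_ne_zero this.ne' hs

end

end ThreeVortex

namespace ThreeVortex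

/-! ### Self-similar motions -/

section

variable {a b : ℝ} (ha : 0 < a) (hb : 0 < b) (hab : a + b = 1) {K : ℝ} (hK : 0 < K)

/-- There are triangles of either orientation with given sides. -/
lemma exists_config {u v : ℝ} (hu : 0 < u) (hv : 0 < v) (h1 : u < 1 + v) (h2 : v < 1 + u)
    (h3 : 1 < u + v) {γ : SignType} (hγ : γ ≠ 0) :
    ∃ c : Config, Function.Injective c ∧ tri c = shape u v ∧ orientation c = γ := by
  -- The vortices are put at `0`, `1` and `x + iy`. The law of cosines gives `x`, and the strict
  -- triangle inequalities give `|x| < v`.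
  set x := (1 + v ^ 2 - u ^ 2) / 2 with hx
  have hy : 0 < v ^ 2 - x ^ 2 := by
    have e1 : 0 < v - x := by rw [hx]; nlinarith
    have e2 : 0 < v + x := by rw [hx]; nlinarith
    nlinarith
  obtain ⟨y, hy2, hsg⟩ : ∃ y : ℝ, y ^ 2 = v ^ 2 - x ^ 2 ∧ SignType.sign y = γ := by
    have := Real.sqrt_pos.2 hy
    cases γ with
    | zero => exact absurd rfl hγ
    | pos => exact ⟨√(v ^ 2 - x ^ 2), Real.sq_sqrt hy.le, sign_pos this⟩
    | neg => exact ⟨-√(v ^ 2 - x ^ 2), by rw [neg_sq, Real.sq_sqrt hy.le], sign_neg (by linarith)⟩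
  set c : Config := ![0, 1, ⟨x, y⟩] with hc
  have s0 : side c 0 = u := by
    rw [← sq_eq_sq₀ (show 0 ≤ side c 0 from norm_nonneg _) hu.le, sq_side_zero]
    simp only [hc, Matrix.cons_val_one, Matrix.cons_val_zero, Matrix.cons_val, Complex.one_re,
      Complex.one_im]
    linear_combination hy2 + 2 * hx
  have s1 : side c 1 = v := by
    rw [← sq_eq_sq₀ (show 0 ≤ side c 1 from norm_nonneg _) hv.le, sq_side_one]
    simp only [hc, Matrix.cons_val_zero, Matrix.cons_val, Complex.zero_re, Complex.zero_im]
    linear_combination hy2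
  have s2 : side c 2 = 1 := by simp [side_two, hc]
  have hinj : Function.Injective c := by
    have n0 : c 1 ≠ c 2 := fun h => by rw [side_zero, h, sub_self, norm_zero] at s0; linarith
    have n1 : c 2 ≠ c 0 := fun h => by rw [side_one, h, sub_self, norm_zero] at s1; linarith
    have n2 : c 0 ≠ c 1 := fun h => by rw [side_two, h, sub_self, norm_zero] at s2; linarith
    intro i j hij
    fin_cases i <;> fin_cases j <;> first | rfl | exact absurd hij (by assumption) |
      exact absurd hij.symm (by assumption)
  refine ⟨c, hinj, ?_, ?_⟩
  · rw [tri_eq_shape hinj, s0, s1, s2, div_one, div_one]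
  · have : signedArea c = y / 2 := by
      rw [signedArea_eq]
      simp [hc]
    rw [orientation, this, ← hsg]
    rcases lt_trichotomy y 0 with h | h | h
    · rw [sign_neg h, sign_neg (by linarith)]
    · simp [h]
    · rw [sign_pos h, sign_pos (by linarith)]

lemma shape_inj {u v u' v' : ℝ} (hu : 0 < u) (hv : 0 < v) (hu' : 0 < u') (hv' : 0 < v')
    (h : shape u v = shape u' v') : u = u' ∧ v = v' := by
  have h0 := congrFun h 0
  have h1 := congrFun h 1
  have h2 := congrFun h 2
  simp only [shape_zero, shape_one, shape_two] at h0 h1 h2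
  have e : 1 + u + v = 1 + u' + v' := by
    rw [div_eq_div_iff (by positivity) (by positivity)] at h2; linarith
  rw [e] at h0 h1
  have hp : 1 + u' + v' ≠ 0 := by positivity
  exact ⟨(div_left_inj' hp).1 h0, (div_left_inj' hp).1 h1⟩

/-- On the critical curve the sides change at the same relative rate. -/
lemma hasDerivAt_side_of_moment (hab : a + b = 1) {z : ℝ → Config} {t : ℝ}
    (h : SolvesAt (scaledStrength K a b) z t) (hM : moment a b (z t) = 0) (j : Fin 3) :
    HasDerivAt (fun s => side (z s) j) (2 * a * b * K * signedArea (z t) *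
      (side (z t) 0 ^ 2 - side (z t) 1 ^ 2) /
      (side (z t) 0 ^ 2 * side (z t) 1 ^ 2 * side (z t) 2 ^ 2) * side (z t) j) t := by
  have h0 := side_pos h.1 0
  have h1 := side_pos h.1 1
  have h2 := side_pos h.1 2
  refine (hasDerivAt_side h j).congr_deriv ?_
  unfold moment at hM
  have e2 : side (z t) 2 ^ 2 = a * side (z t) 0 ^ 2 + b * side (z t) 1 ^ 2 := by linarith
  obtain rfl : b = 1 - a := by linarith
  fin_cases j
  · simp only [Fin.zero_eta, scaledStrength_zero, zero_add]
    field_simp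
    linear_combination (1 - a) * signedArea (z t) * K * e2
  · simp only [Fin.mk_one, scaledStrength_one,
      show (1 : Fin 3) + 1 = 2 from rfl, show (1 : Fin 3) + 2 = 0 from rfl]
    field_simp
    linear_combination -a * signedArea (z t) * K * e2
  · simp only [Fin.reduceFinMk, scaledStrength_two,
      show (2 : Fin 3) + 1 = 0 from rfl, show (2 : Fin 3) + 2 = 1 from rfl]
    field_simp
    ring

lemma hasDerivAt_perimeter {z : ℝ → Config} {t : ℝ} {d : Fin 3 → ℝ}
    (h : ∀ j, HasDerivAt (fun s => side (z s) j) (d j) t) :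
    HasDerivAt (fun s => perimeter (z s)) (∑ j, d j) t := by
  unfold perimeter
  exact HasDerivAt.fun_sum fun j _ => h j

include hab in
/-- The rate of change of the perimeter on the critical curve. -/
lemma hasDerivAt_perimeter_of_moment {z : ℝ → Config} {t : ℝ}
    (h : SolvesAt (scaledStrength K a b) z t) (hM : moment a b (z t) = 0) :
    HasDerivAt (fun s => perimeter (z s)) (2 * a * b * K * signedArea (z t) *
      (side (z t) 0 ^ 2 - side (z t) 1 ^ 2) /
      (side (z t) 0 ^ 2 * side (z t) 1 ^ 2 * side (z t) 2 ^ 2) * perimeter (z t)) t := by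
  refine (hasDerivAt_perimeter (hasDerivAt_side_of_moment hab h hM)).congr_deriv ?_
  rw [perimeter, Finset.mul_sum]

include ha hb hab hK in
-- All sides share one relative rate, so the shape is stationary and the perimeter changes at a
-- positive multiple of `A (u - v)`; `hP` asks for `P` on such rates.
lemma isSelfSimilar_shape {u v : ℝ} (hu : 0 < u) (hv : 0 < v) (h1 : u < 1 + v) (h2 : v < 1 + u)
    (he : ellipse a b u v = 0) {γ : SignType} (hγ : γ ≠ 0) {P : ℝ → Prop}
    (hP : ∀ C > 0, ∀ A : ℝ, SignType.sign A = γ → P (C * (A * (u - v)))) :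
    IsSelfSimilar (scaledStrength K a b) (shape u v) γ P := by
  refine ⟨exists_config hu hv h1 h2 (one_lt_add_of_ellipse ha hb hab hu hv he) hγ, ?_⟩
  intro z hz hx hor
  have p0 := side_pos hz.1 0
  have p1 := side_pos hz.1 1
  have p2 := side_pos hz.1 2
  have pp := perimeter_pos hz.1
  obtain ⟨e0, e1⟩ := shape_inj (div_pos p0 p2) (div_pos p1 p2) hu hv
    ((tri_eq_shape hz.1).symm.trans hx)
  have hM : moment a b (z 0) = 0 := by rw [moment_eq hz.1, e0, e1, he, mul_zero]
  have hs := hasDerivAt_side_of_moment hab hz hM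
  have hp := hasDerivAt_perimeter_of_moment hab hz hM
  refine ⟨fun j => ?_, _, ?_, hp⟩
  · refine ((hs j).div hp pp.ne').congr_deriv ?_
    field_simp
    ring
  · have := hP (2 * a * b * K * side (z 0) 2 * (side (z 0) 0 + side (z 0) 1) /
      (side (z 0) 0 ^ 2 * side (z 0) 1 ^ 2 * side (z 0) 2 ^ 2) * perimeter (z 0))
      (by positivity) (signedArea (z 0)) hor
    convert this using 1
    rw [← e0, ← e1]
    field_simp
    ring

include ha hb hab hK in
lemma isContracting_right {u v : ℝ} (hu : 0 < u) (huv : u < v) (h2 : v < 1 + u)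
    (he : ellipse a b u v = 0) : IsContracting (scaledStrength K a b) (shape u v) 1 :=
  isSelfSimilar_shape ha hb hab hK hu (hu.trans huv) (by linarith) h2 he (by decide)
    fun C hC A hA => by
      have := sign_eq_one_iff.1 hA
      exact mul_neg_of_pos_of_neg hC (mul_neg_of_pos_of_neg this (by linarith))

include ha hb hab hK in
lemma isExpanding_right {u v : ℝ} (hu : 0 < u) (huv : u < v) (h2 : v < 1 + u)
    (he : ellipse a b u v = 0) : IsExpanding (scaledStrength K a b) (shape u v) (-1) :=
  isSelfSimilar_shape ha hb hab hK hu (hu.trans huv) (by linarith) h2 he (by decide)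
    fun C hC A hA => by
      have := sign_eq_neg_one_iff.1 hA
      exact mul_pos hC (mul_pos_of_neg_of_neg this (by linarith))

include ha hb hab hK in
lemma isContracting_left {u v : ℝ} (hv : 0 < v) (huv : v < u) (h2 : u < 1 + v)
    (he : ellipse a b u v = 0) : IsContracting (scaledStrength K a b) (shape u v) (-1) :=
  isSelfSimilar_shape ha hb hab hK (hv.trans huv) hv h2 (by linarith) he (by decide)
    fun C hC A hA => by
      have := sign_eq_neg_one_iff.1 hA
      exact mul_neg_of_pos_of_neg hC (mul_neg_of_neg_of_pos this (by linarith))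

include ha hb hab hK in
lemma isExpanding_left {u v : ℝ} (hv : 0 < v) (huv : v < u) (h2 : u < 1 + v)
    (he : ellipse a b u v = 0) : IsExpanding (scaledStrength K a b) (shape u v) 1 :=
  isSelfSimilar_shape ha hb hab hK (hv.trans huv) hv h2 (by linarith) he (by decide)
    fun C hC A hA => by
      have := sign_eq_one_iff.1 hA
      exact mul_pos hC (mul_pos this (by linarith))

include ha hb hab hK in
/-- The contracting points lie on the right part of the critical curve on the positive side and
on the left part on the negative side. -/
lemma of_isContracting {q : Fin 3 → ℝ} {γ : SignType}
    (h : IsContracting (scaledStrength K a b) q γ) :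
    ∃ u v, 0 < u ∧ 0 < v ∧ q = shape u v ∧ ellipse a b u v = 0 ∧
      (γ = 1 ∧ u < v ∧ v < 1 + u ∨ γ = -1 ∧ v < u ∧ u < 1 + v) := by
  obtain ⟨⟨c, hc, hcq, hcγ⟩, h⟩ := h
  set k := scaledStrength K a b with hk
  -- A straight line with the right velocities suffices as test curve, since the definition looks at
  -- time 0 only.
  let z : ℝ → Config := fun t j => c j + t * velocity k c j
  have hz0 : z 0 = c := by funext j; simp [z]
  have hz : SolvesAt k z 0 := by
    refine ⟨by rw [hz0]; exact hc, fun j => ?_⟩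
    rw [hz0]
    have h1 : HasDerivAt (fun t : ℝ => (t : ℂ)) 1 0 := Complex.ofRealCLM.hasDerivAt
    simpa [z] using (h1.mul_const (velocity k c j)).const_add (c j)
  obtain ⟨htri, r, hr, hper⟩ := h z hz (by rw [hz0, hcq]) (by rw [hz0, hcγ])
  have p0 := side_pos hc 0
  have p1 := side_pos hc 1
  have p2 := side_pos hc 2
  have pp := perimeter_pos hc
  -- A stationary shape has `R_j' = x_j r`, so the impulse changes at the rate `2 r M / p`. It is
  -- conserved and `r < 0`, hence `M = 0`.
  have hM : moment a b c = 0 := by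
    have hm := hasDerivAt_moment hz
    have hside : ∀ j, HasDerivAt (fun t => side (z t) j) (tri c j * r) 0 := fun j => by
      have h1 := (htri j).mul hper
      simp only [zero_mul, zero_add, hz0] at h1
      refine h1.congr_of_eventuallyEq ?_
      have : ∀ᶠ t in 𝓝 (0 : ℝ), perimeter (z t) ≠ 0 :=
        hper.continuousAt.eventually_ne (by rw [hz0]; exact pp.ne')
      filter_upwards [this] with t ht
      simp [tri, ht]
    have hd := ((((hside 2).pow 2).sub (((hside 0).pow 2).const_mul a)).sub
      (((hside 1).pow 2).const_mul b)).unique hm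
    simp only [hz0, tri] at hd
    have e : 2 * r / perimeter c * moment a b c = 0 := by
      rw [← hd, moment]; field_simp; ring
    have hr0 : 2 * r / perimeter c ≠ 0 := div_ne_zero (by linarith) pp.ne'
    exact (mul_eq_zero.1 e).resolve_left hr0
  have hM0 : moment a b (z 0) = 0 := by rw [hz0, hM]
  have hr' := hper.unique (hasDerivAt_perimeter_of_moment hab hz hM0)
  rw [hz0] at hr'
  set C := 2 * a * b * K * (side c 0 + side c 1) /
      (side c 0 ^ 2 * side c 1 ^ 2 * side c 2 ^ 2) * perimeter c with hC
  have hCp : 0 < C := by positivity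
  have hr2 : r = C * (signedArea c * (side c 0 - side c 1)) := by
    rw [hr', hC]; field_simp; ring
  have hneg : signedArea c * (side c 0 - side c 1) < 0 := by
    rw [hr2] at hr
    exact (pos_iff_neg_of_mul_neg hr).1 hCp
  have hA : signedArea c ≠ 0 := by rintro h; rw [h, zero_mul] at hneg; exact lt_irrefl _ hneg
  obtain ⟨t0, t1⟩ := side_lt_of_signedArea_ne_zero hA
  refine ⟨side c 0 / side c 2, side c 1 / side c 2, div_pos p0 p2, div_pos p1 p2,
    hcq.symm.trans (tri_eq_shape hc), ?_, ?_⟩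
  · rw [moment_eq hc] at hM
    exact (mul_eq_zero.1 hM).resolve_left (by positivity)
  · have l1 : side c 1 / side c 2 < 1 + side c 0 / side c 2 := by
      rw [← div_self p2.ne', ← add_div, div_lt_div_iff_of_pos_right p2]; linarith
    have l0 : side c 0 / side c 2 < 1 + side c 1 / side c 2 := by
      rw [← div_self p2.ne', ← add_div, div_lt_div_iff_of_pos_right p2]; linarith
    rw [div_lt_div_iff_of_pos_right p2, div_lt_div_iff_of_pos_right p2, ← hcγ]
    rcases mul_neg_iff.1 hneg with ⟨h1, h2⟩ | ⟨h1, h2⟩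
    · exact .inl ⟨orientation_eq_one_iff.2 h1, by linarith, l1⟩
    · exact .inr ⟨orientation_eq_neg_one_iff.2 h1, by linarith, l0⟩

end

end ThreeVortex

namespace ThreeVortex

/-! ### Global existence -/

section Ode

open Metric ODE
open scoped NNReal

variable {E : Type*} [NormedAddCommGroup E] [NormedSpace ℝ E]

/-- The Picard-Lindelöf theorem, with the information that the solution stays in the ball. -/
lemma exists_solution_mem_closedBall [CompleteSpace E] {f : E → E} {x : E} {r L K : ℝ≥0} {η : ℝ}
    (hη : 0 < η) (hb : ∀ y ∈ closedBall x r, ‖f y‖ ≤ L) (hl : LipschitzOnWith K f (closedBall x r))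
    (hm : L * η ≤ r) :
    ∃ α : ℝ → E, α 0 = x ∧ ∀ t ∈ Ioo (-η) η, α t ∈ closedBall x r ∧ HasDerivAt α (f (α t)) t := by
  have h0 : (0 : ℝ) ∈ Icc (-η) η := ⟨by linarith, hη.le⟩
  have hf : IsPicardLindelof (fun _ => f) (⟨0, h0⟩ : Icc (-η) η) x r 0 L K :=
    .of_time_independent hb hl (by simpa using hm)
  -- The fixed point itself is kept, because elements of `FunSpace` carry the bound that confines
  -- them to the ball.
  obtain ⟨α, hα⟩ := FunSpace.exists_isFixedPt_next hf (mem_closedBall_self le_rfl)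
  have hball : ∀ t, α.compProj t ∈ closedBall x (r : ℝ) := fun t =>
    α.compProj_mem_closedBall hf.mul_max_le
  refine ⟨α.compProj, ?_, fun t ht => ⟨hball t, ?_⟩⟩
  · have : α.compProj (⟨0, h0⟩ : Icc (-η) η) = x := by
      rw [FunSpace.compProj_val, ← hα, FunSpace.next_apply₀]
    exact this
  · have ht' : t ∈ Icc (-η) η := Ioo_subset_Icc_self ht
    refine HasDerivWithinAt.hasDerivAt (s := Icc (-η) η) ?_ (Icc_mem_nhds ht.1 ht.2)
    apply hasDerivWithinAt_picard_Icc h0 hf.continuousOn_uncurry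
      α.continuous_compProj.continuousOn (fun t' _ => hball t') x ht' |>.congr_of_mem _ ht'
    intro t' ht'
    nth_rw 1 [← hα]
    rw [FunSpace.compProj_of_mem ht', FunSpace.next_apply]

/-- Solutions that exist for a uniform time can be continued for ever. -/
lemma exists_forward_solution {f : E → E} {S : Set E} {η : ℝ} (hη : 0 < η)
    (h : ∀ x ∈ S, ∃ α : ℝ → E, α 0 = x ∧ ∀ t ∈ Icc 0 η, α t ∈ S ∧ HasDerivAt α (f (α t)) t)
    {x : E} (hx : x ∈ S) :
    ∃ α : ℝ → E, α 0 = x ∧ ∀ t, 0 ≤ t → α t ∈ S ∧ HasDerivWithinAt α (f (α t)) (Ici 0) t := by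
  choose! Z hZ0 hZ using h
  -- The state at time `n η`, from which the next local solution starts.
  let c : ℕ → E := fun n => Nat.rec x (fun _ y => Z y η) n
  have hc : ∀ n, c n ∈ S := fun n => by
    induction n with
    | zero => exact hx
    | succ n ih => exact (hZ _ ih η ⟨hη.le, le_rfl⟩).1
  let α : ℝ → E := fun t => Z (c ⌊t / η⌋₊) (t - ⌊t / η⌋₊ * η)
  have hα : ∀ (n : ℕ), ∀ t ∈ Icc (n * η) ((n + 1) * η), α t = Z (c n) (t - n * η) := by
    intro n t ht
    have h0 : 0 ≤ t / η := div_nonneg (le_trans (by positivity) ht.1) hη.le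
    rcases ht.2.lt_or_eq with h | h
    · have : ⌊t / η⌋₊ = n := (Nat.floor_eq_iff h0).2
        ⟨by rw [le_div_iff₀ hη]; exact ht.1, by rw [div_lt_iff₀ hη]; exact h⟩
      simp only [α, this]
    -- At the right end the floor already selects the next piece, whose initial value is the final
    -- value of this one.
    · have : ⌊t / η⌋₊ = n + 1 := by
        rw [h, mul_div_cancel_right₀ _ hη.ne']; exact_mod_cast Nat.floor_natCast (n + 1)
      simp only [α, this]
      have e1 : t - ((n + 1 : ℕ) : ℝ) * η = 0 := by push_cast; linarith
      have e2 : t - n * η = η := by linarith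
      rw [e1, e2]
      exact hZ0 _ (hc (n + 1))
  have hd : ∀ (n : ℕ), ∀ t ∈ Icc (n * η) ((n + 1) * η), α t ∈ S ∧
      HasDerivWithinAt α (f (α t)) (Icc (n * η) ((n + 1) * η)) t := by
    intro n t ht
    obtain ⟨h1, h2⟩ := hZ _ (hc n) (t - n * η) ⟨by linarith [ht.1], by linarith [ht.2]⟩
    rw [hα n t ht]
    exact ⟨h1, (h2.comp_sub_const t (n * η)).hasDerivWithinAt.congr (hα n) (hα n t ht)⟩
  refine ⟨α, ?_, fun t ht => ?_⟩
  · simpa [hZ0 _ hx, c] using hα 0 0 (by simp [hη.le])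
  · set n := ⌊t / η⌋₊ with hn
    have h0 : 0 ≤ t / η := div_nonneg ht hη.le
    have h1 : n * η ≤ t := by rw [← le_div_iff₀ hη]; exact Nat.floor_le h0
    have h2 : t < (n + 1) * η := by rw [← div_lt_iff₀ hη]; exact Nat.lt_floor_add_one _
    obtain ⟨hS, hn1⟩ := hd n t ⟨h1, h2.le⟩
    refine ⟨hS, ?_⟩
    rcases h1.lt_or_eq with h3 | h3
    · exact (hn1.hasDerivAt (Icc_mem_nhds h3 h2)).hasDerivWithinAt
    · cases hn' : n with
      | zero =>
        rw [hn'] at h3 hn1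
        simp only [Nat.cast_zero, zero_mul, zero_add, one_mul] at h3 hn1
        subst h3
        exact hn1.mono_of_mem_nhdsWithin (Icc_mem_nhdsGE hη)
      | succ m =>
        rw [hn'] at h3 hn1
        push_cast at h3 hn1
        -- At a joint the previous piece supplies the left derivative and the next piece the right
        -- one.
        obtain ⟨-, hn2⟩ := hd m t ⟨by linarith, h3.ge⟩
        rw [h3] at hn1 hn2
        refine ((hn2.union hn1).hasDerivAt ?_).hasDerivWithinAt
        rw [Icc_union_Icc_eq_Icc (by linarith) (by linarith)]
        exact Icc_mem_nhds (by linarith) (by linarith)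

/-- Solutions that exist for a uniform time can be continued for ever in both directions. -/
lemma exists_global_solution {f : E → E} {S : Set E} {η : ℝ} (hη : 0 < η)
    (h : ∀ x ∈ S, ∃ α : ℝ → E, α 0 = x ∧ ∀ t ∈ Icc (-η) η, α t ∈ S ∧ HasDerivAt α (f (α t)) t)
    {x : E} (hx : x ∈ S) :
    ∃ α : ℝ → E, α 0 = x ∧ ∀ t, α t ∈ S ∧ HasDerivAt α (f (α t)) t := by
  obtain ⟨p, hp0, hp⟩ := exists_forward_solution (f := f) (S := S) hη (fun y hy => by
    obtain ⟨α, h0, h1⟩ := h y hy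
    exact ⟨α, h0, fun t ht => h1 t ⟨by linarith [ht.1], ht.2⟩⟩) hx
  -- The past is a forward solution of the reversed field, glued on at time 0.
  obtain ⟨m, hm0, hm⟩ := exists_forward_solution (f := fun y => -f y) (S := S) hη (fun y hy => by
    obtain ⟨α, h0, h1⟩ := h y hy
    refine ⟨fun t => α (-t), by simpa using h0, fun t ht => ?_⟩
    obtain ⟨h2, h3⟩ := h1 (-t) ⟨by linarith [ht.2], by linarith [ht.1]⟩
    exact ⟨h2, hasDerivAt_comp_neg h3⟩) hx
  let α : ℝ → E := fun t => if 0 ≤ t then p t else m (-t)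
  have hαp : ∀ t ∈ Ici (0 : ℝ), α t = p t := fun t ht => if_pos ht
  have hαm : ∀ t ∈ Iic (0 : ℝ), α t = m (-t) := fun t ht => by
    rcases (mem_Iic.1 ht).lt_or_eq with h | h
    · exact if_neg (not_le.2 h)
    · subst h; rw [hαp 0 (by simp), neg_zero, hp0, hm0]
  have d1 : ∀ t, 0 ≤ t → α t ∈ S ∧ HasDerivWithinAt α (f (α t)) (Ici 0) t := fun t ht => by
    rw [hαp t ht]
    exact ⟨(hp t ht).1, (hp t ht).2.congr hαp (hαp t ht)⟩
  have d2 : ∀ t, t ≤ 0 → α t ∈ S ∧ HasDerivWithinAt α (f (α t)) (Iic 0) t := fun t ht => by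
    rw [hαm t ht]
    obtain ⟨h1, h2⟩ := hm (-t) (by linarith)
    have h3 := HasDerivWithinAt.scomp (h := fun s : ℝ => -s) (s := Iic 0) t h2
      (hasDerivAt_neg t).hasDerivWithinAt (fun s hs => neg_nonneg.2 (mem_Iic.1 hs))
    rw [neg_smul, one_smul, neg_neg] at h3
    exact ⟨h1, h3.congr hαm (hαm t ht)⟩
  refine ⟨α, (hαp 0 (by simp)).trans hp0, fun t => ?_⟩
  rcases lt_trichotomy t 0 with ht | ht | ht
  · exact ⟨(d2 t ht.le).1, (d2 t ht.le).2.hasDerivAt (Iic_mem_nhds ht)⟩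
  · refine ⟨(d1 t ht.ge).1, ((d2 t ht.le).2.union (d1 t ht.ge).2).hasDerivAt ?_⟩
    rw [Iic_union_Ici]; exact univ_mem
  · exact ⟨(d1 t ht.le).1, (d1 t ht.le).2.hasDerivAt (Ici_mem_nhds ht)⟩

end Ode

/-! ### Bounds for the velocity field on separated configurations -/

section Velocity

variable {k : Fin 3 → ℝ} {δ : ℝ}

lemma norm_velocity_le (hδ : 0 < δ) {c : Config} (hc : ∀ i j, i ≠ j → δ ≤ ‖c i - c j‖) (j : Fin 3) :
    ‖velocity k c j‖ ≤ (∑ m, |k m|) / δ := by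
  rw [velocity, norm_mul, norm_neg, Complex.norm_I, one_mul]
  refine (norm_sum_le _ _).trans ?_
  rw [Finset.sum_div]
  refine (Finset.sum_le_sum fun m hm => ?_).trans
    (Finset.sum_le_sum_of_subset_of_nonneg (Finset.subset_univ _) fun m _ _ => by positivity)
  rw [← map_sub, norm_div, RCLike.norm_conj, Complex.norm_real, Real.norm_eq_abs]
  exact div_le_div_of_nonneg_left (abs_nonneg _) hδ (hc m j (Finset.ne_of_mem_erase hm))

lemma norm_velocity_sub_le (hδ : 0 < δ) {c c' : Config} (hc : ∀ i j, i ≠ j → δ ≤ ‖c i - c j‖)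
    (hc' : ∀ i j, i ≠ j → δ ≤ ‖c' i - c' j‖) (j : Fin 3) :
    ‖velocity k c j - velocity k c' j‖ ≤ (∑ m, |k m|) * (2 / δ ^ 2) * ‖c - c'‖ := by
  rw [velocity, velocity, ← mul_sub, norm_mul, norm_neg, Complex.norm_I, one_mul,
    ← Finset.sum_sub_distrib]
  refine (norm_sum_le _ _).trans ?_
  rw [Finset.sum_mul, Finset.sum_mul]
  refine (Finset.sum_le_sum fun m hm => ?_).trans
    (Finset.sum_le_sum_of_subset_of_nonneg (Finset.subset_univ _) fun m _ _ => by positivity)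
  have hmj := Finset.ne_of_mem_erase hm
  have h1 := hc m j hmj
  have h2 := hc' m j hmj
  have n1 : (starRingEnd ℂ) (c m - c j) ≠ 0 := by
    rw [← norm_ne_zero_iff, RCLike.norm_conj]; linarith
  have n2 : (starRingEnd ℂ) (c' m - c' j) ≠ 0 := by
    rw [← norm_ne_zero_iff, RCLike.norm_conj]; linarith
  rw [← map_sub, ← map_sub, div_sub_div _ _ n1 n2, mul_comm _ (k m : ℂ), ← mul_sub, ← map_sub,
    norm_div, norm_mul, norm_mul, RCLike.norm_conj, RCLike.norm_conj, RCLike.norm_conj,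
    Complex.norm_real, Real.norm_eq_abs, mul_assoc, mul_div_assoc]
  refine mul_le_mul_of_nonneg_left ?_ (abs_nonneg _)
  have h3 : ‖c' m - c' j - (c m - c j)‖ ≤ 2 * ‖c - c'‖ := by
    have e : c' m - c' j - (c m - c j) = (c - c') j - (c - c') m := by
      simp only [Pi.sub_apply]; ring
    rw [e]
    refine (norm_sub_le _ _).trans ?_
    linarith [norm_le_pi_norm (c - c') j, norm_le_pi_norm (c - c') m]
  calc _ ≤ 2 * ‖c - c'‖ / (δ * δ) := by gcongr
    _ = _ := by ring

end Velocity

section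

open Metric

variable {a b : ℝ} (ha : 0 < a) (hb : 0 < b) (hab : a + b = 1) {K : ℝ}

lemma le_norm_sub_of_side {c : Config} {δ : ℝ} (h : ∀ j, δ ≤ side c j) (i j : Fin 3)
    (hij : i ≠ j) : δ ≤ ‖c i - c j‖ := by
  have h0 := h 0
  have h1 := h 1
  have h2 := h 2
  rw [side_zero] at h0
  rw [side_one] at h1
  rw [side_two] at h2
  fin_cases i <;> fin_cases j <;> first | exact absurd rfl hij | assumption |
    (rw [norm_sub_rev]; assumption)

include ha hb hab in
/-- The motion exists for all times on a level curve with nonvanishing angular impulse. -/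
lemma exists_isMotion {c : Config} (hc : Function.Injective c) (hl : level a b c < 0)
    (hM : moment a b c ≠ 0) : ∃ z : ℝ → Config, IsMotion (scaledStrength K a b) z ∧ z 0 = c := by
  set k := scaledStrength K a b with hk
  obtain ⟨δ, hδ, hside⟩ := exists_side_bound ha hb hab hl hM
  -- The separation `δ` is uniform on this common level set of both invariants, so the time step
  -- does not shrink from piece to piece.
  set S : Set Config := {c' | Function.Injective c' ∧ level a b c' = level a b c ∧
    moment a b c' = moment a b c}
  set κ := ∑ m, |k m|
  have hκ : 0 ≤ κ := Finset.sum_nonneg fun _ _ => abs_nonneg _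
  have hapart : ∀ x ∈ S, ∀ y ∈ closedBall x (δ / 4), ∀ i j, i ≠ j → δ / 2 ≤ ‖y i - y j‖ := by
    intro x hx y hy i j hij
    have h1 := le_norm_sub_of_side (hside x hx.1 hx.2.1 hx.2.2) i j hij
    have h2 : ∀ i, ‖x i - y i‖ ≤ δ / 4 := fun i => by
      refine (norm_le_pi_norm (x - y) i).trans ?_
      rw [norm_sub_rev]; exact mem_closedBall_iff_norm.1 hy
    have h3 : x i - x j = (y i - y j) + (x i - y i) - (x j - y j) := by ring
    have h4 := norm_sub_le ((y i - y j) + (x i - y i)) (x j - y j)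
    rw [← h3] at h4
    have h5 := norm_add_le (y i - y j) (x i - y i)
    linarith [h2 i, h2 j]
  -- The summand 1 makes `L` positive from `κ ≥ 0` alone.
  set L := κ / (δ / 2) + 1
  have hL : 0 < L := by positivity
  set η := δ / 4 / L
  have hη : 0 < η := by positivity
  have key : ∀ x ∈ S, ∃ α : ℝ → Config, α 0 = x ∧ ∀ t ∈ Icc (-(η / 2)) (η / 2),
      α t ∈ S ∧ HasDerivAt α (fun j => velocity k (α t) j) t := by
    intro x hx
    obtain ⟨α, h0, hα⟩ := exists_solution_mem_closedBall (f := fun y j => velocity k y j) (x := x)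
      (r := ⟨δ / 4, by positivity⟩) (L := ⟨L, hL.le⟩) (K := ⟨κ * (2 / (δ / 2) ^ 2), by positivity⟩)
      hη (fun y hy => (pi_norm_le_iff_of_nonneg hL.le).2 fun j =>
        (norm_velocity_le (half_pos hδ) (hapart x hx y hy) j).trans (by simp [L, κ]))
      (LipschitzOnWith.of_dist_le_mul fun y hy y' hy' => by
        rw [dist_eq_norm, dist_eq_norm]
        exact (pi_norm_le_iff_of_nonneg (mul_nonneg (NNReal.coe_nonneg _) (norm_nonneg _))).2 fun j =>
          norm_velocity_sub_le (half_pos hδ) (hapart x hx y hy) (hapart x hx y' hy') j)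
      (by change L * η ≤ δ / 4; exact (mul_div_cancel₀ _ hL.ne').le)
    have hsub : Icc (-(η / 2)) (η / 2) ⊆ Ioo (-η) η := Icc_subset_Ioo (by linarith) (by linarith)
    have hsol : ∀ t ∈ Icc (-(η / 2)) (η / 2), SolvesAt k α t := fun t ht => by
      obtain ⟨h1, h2⟩ := hα t (hsub ht)
      refine ⟨fun i j hij => ?_, fun j => hasDerivAt_pi.1 h2 j⟩
      by_contra hne
      have := hapart x hx _ h1 i j hne
      rw [hij, sub_self, norm_zero] at this
      linarith
    have hconst : ∀ F : Config → ℝ, (∀ t, SolvesAt k α t → HasDerivAt (fun s => F (α s)) 0 t) →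
        ∀ t ∈ Icc (-(η / 2)) (η / 2), F (α t) = F x := by
      intro F hF
      have h1 := constant_of_has_deriv_right_zero (f := fun s => F (α s))
        (fun t ht => (hF t (hsol t ht)).continuousAt.continuousWithinAt)
        (fun t ht => (hF t (hsol t (Ico_subset_Icc_self ht))).hasDerivWithinAt)
      intro t ht
      rw [h1 t ht, ← h0]
      exact (h1 0 ⟨by linarith, by linarith⟩).symm
    refine ⟨α, h0, fun t ht => ⟨⟨(hsol t ht).1, ?_, ?_⟩, (hα t (hsub ht)).2⟩⟩
    · exact (hconst _ (fun t => hasDerivAt_level) t ht).trans hx.2.1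
    · exact (hconst _ (fun t => hasDerivAt_moment) t ht).trans hx.2.2
  obtain ⟨z, hz0, hz⟩ := exists_global_solution (half_pos hη) key (x := c) ⟨hc, rfl, rfl⟩
  exact ⟨z, fun t => ⟨(hz t).1.1, fun j => hasDerivAt_pi.1 (hz t).2 j⟩, hz0⟩

end

end ThreeVortex

namespace ThreeVortex

/-! ### The types of motions -/

/-- The point of the level curve `l` with the coordinate `s`. -/
noncomputable def levelPoint (a b l s : ℝ) : Fin 3 → ℝ :=
  shape (Real.exp (l - b * s)) (Real.exp (l + a * s))

/-- The form of the critical curve along the level curve `l`. -/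
noncomputable def levelForm (a b l s : ℝ) : ℝ :=
  ellipse a b (Real.exp (l - b * s)) (Real.exp (l + a * s))

lemma levelForm_swap (a b l s : ℝ) : levelForm a b l s = levelForm b a l (-s) := by
  rw [levelForm, levelForm, ellipse_swap]; congr 2 <;> ring

lemma pos_of_continuous_of_ne_zero {f : ℝ → ℝ} (hf : Continuous f) (h0 : ∀ t, f t ≠ 0)
    (h : ∃ t, 0 < f t) (t : ℝ) : 0 < f t := by
  obtain ⟨t₁, h1⟩ := h
  by_contra! h2
  obtain ⟨x, hx⟩ := mem_range_of_exists_le_of_exists_ge hf ⟨t, h2⟩ ⟨t₁, h1.le⟩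
  exact h0 x hx

section

variable {a b : ℝ} (ha : 0 < a) (hb : 0 < b) (hab : a + b = 1) {K : ℝ} (hK : 0 < K)

@[fun_prop]
lemma continuous_levelForm (a b l : ℝ) : Continuous (levelForm a b l) := by
  unfold levelForm ellipse; fun_prop

lemma continuous_levelPoint (a b l : ℝ) : Continuous (levelPoint a b l) := by
  unfold levelPoint shape
  refine continuous_pi fun i => ?_
  have : ∀ s, 1 + Real.exp (l - b * s) + Real.exp (l + a * s) ≠ 0 := fun s => by positivity
  fin_cases i <;> simp <;> fun_prop (disch := exact this _)

include hab in
-- At `s = 0` both ratios equal `exp l < 1`. Thus 0 separates the critical points of the level.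
lemma levelForm_zero_pos {l : ℝ} (hl : l < 0) : 0 < levelForm a b l 0 := by
  have : Real.exp l < 1 := by simpa using Real.exp_lt_exp.2 hl
  have := Real.exp_pos l
  simp only [levelForm, ellipse, mul_zero, sub_zero, add_zero]
  obtain rfl : b = 1 - a := by linarith
  nlinarith

include ha hb hab in
/-- Each level curve meets the right part of the critical curve (in a wider sense) once. -/
lemma exists_critical_right {l : ℝ} (hl : l < 0) : ∃ s, 0 < s ∧ levelForm a b l s = 0 ∧
    ∀ s', 0 < s' → levelForm a b l s' = 0 → s' = s := by
  have h0 := levelForm_zero_pos hab hl (a := a)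
  have hb1 : Real.log b < 0 := Real.log_neg hb (by linarith)
  -- Chosen so that `b v² = 1`, which makes the form negative.
  set s₁ := (-2 * l - Real.log b) / (2 * a) with hs₁
  have hs₁p : 0 < s₁ := div_pos (by linarith) (by linarith)
  have h1 : levelForm a b l s₁ ≤ 0 := by
    have e : b * Real.exp (l + a * s₁) ^ 2 = 1 := by
      nth_rw 1 [← Real.exp_log hb]
      rw [← Real.exp_nat_mul, ← Real.exp_add, Real.exp_eq_one_iff, hs₁]
      push_cast
      field_simp
      ring
    have := Real.exp_pos (l - b * s₁)
    rw [levelForm, ellipse, e]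
    have : 0 < a * Real.exp (l - b * s₁) ^ 2 := by positivity
    linarith
  obtain ⟨s, hs, hs0⟩ := intermediate_value_Icc' hs₁p.le
    (continuous_levelForm a b l).continuousOn ⟨h1, h0.le⟩
  have hsp : 0 < s := lt_of_le_of_ne hs.1 fun h => by rw [← h] at hs0; linarith
  refine ⟨s, hsp, hs0, fun s' hs' hs0' => ?_⟩
  have := eq_of_logLevel_eq ha hb hab (Real.exp_pos _) (Real.exp_pos _)
    ((exp_lt_exp_iff_pos hab l s).2 hsp).le ((exp_lt_exp_iff_pos hab l s').2 hs').le hs0 hs0'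
    (by rw [logLevel_exp hab, logLevel_exp hab])
  have h2 := Real.exp_injective this.2
  exact (mul_left_cancel₀ ha.ne' (by linarith : a * s = a * s')).symm

include ha hb hab in
lemma exists_critical_left {l : ℝ} (hl : l < 0) : ∃ s, s < 0 ∧ levelForm a b l s = 0 ∧
    ∀ s', s' < 0 → levelForm a b l s' = 0 → s' = s := by
  obtain ⟨s, h1, h2, h3⟩ := exists_critical_right hb ha (by linarith) hl
  refine ⟨-s, by linarith, by rwa [levelForm_swap, neg_neg], fun s' hs' h => ?_⟩
  rw [levelForm_swap] at h
  linarith [h3 (-s') (by linarith) h]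

include ha hb hab in
-- Each sign of `s` admits only one zero and 0 is none, so two distinct zeros straddle it.
lemma neg_pos_of_critical {l s s' : ℝ} (hl : l < 0) (hs : s < s') (he : levelForm a b l s = 0)
    (he' : levelForm a b l s' = 0) : s < 0 ∧ 0 < s' := by
  have h0 := levelForm_zero_pos (a := a) hab hl
  obtain ⟨p, -, -, hp⟩ := exists_critical_right ha hb hab hl
  obtain ⟨m, -, -, hm⟩ := exists_critical_left ha hb hab hl
  have n1 : s ≠ 0 := fun h => by rw [h] at he; linarith
  have n2 : s' ≠ 0 := fun h => by rw [h] at he'; linarith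
  constructor
  · by_contra! h
    have h1 : 0 < s := lt_of_le_of_ne h n1.symm
    linarith [hp s h1 he, hp s' (h1.trans hs) he']
  · by_contra! h
    have h1 : s' < 0 := lt_of_le_of_ne h n2
    linarith [hm s' h1 he', hm s (hs.trans h1) he]

include ha hb hab hK in
lemma levelPoint_right {l s : ℝ} (hl : endLevel a b < l) (hs : 0 < s)
    (he : levelForm a b l s = 0) :
    IsContracting (scaledStrength K a b) (levelPoint a b l s) 1 ∧
    IsExpanding (scaledStrength K a b) (levelPoint a b l s) (-1) ∧
    levelPoint a b l s ∈ arc (scaledStrength K a b) pointE (pointQ5 (scaledStrength K a b)) := by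
  have huv := (exp_lt_exp_iff_pos hab l s).2 hs
  have hl' := hl
  rw [← logLevel_exp hab l s] at hl'
  have h2 := (lt_one_add_iff ha hb hab (Real.exp_pos _) huv he).2 hl'
  exact ⟨isContracting_right ha hb hab hK (Real.exp_pos _) huv h2 he,
    isExpanding_right ha hb hab hK (Real.exp_pos _) huv h2 he,
    shape_mem_arc_E_Q5 ha hb hab hK (Real.exp_pos _) huv he hl'⟩

include ha hb hab hK in
lemma levelPoint_left {l s : ℝ} (hl : endLevel b a < l) (hs : s < 0)
    (he : levelForm a b l s = 0) :
    IsContracting (scaledStrength K a b) (levelPoint a b l s) (-1) ∧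
    IsExpanding (scaledStrength K a b) (levelPoint a b l s) 1 ∧
    levelPoint a b l s ∈ arc (scaledStrength K a b) (pointQ4 (scaledStrength K a b)) pointE := by
  have huv := (exp_lt_exp_iff_neg hab l s).2 hs
  have hl' := hl
  rw [← logLevel_exp hab l s] at hl'
  have hl'' := hl'
  rw [logLevel_swap] at hl''
  have he' := he
  rw [levelForm, ellipse_swap] at he'
  have h2 := (lt_one_add_iff hb ha (by linarith) (Real.exp_pos _) huv he').2 hl''
  exact ⟨isContracting_left ha hb hab hK (Real.exp_pos _) huv h2 he,
    isExpanding_left ha hb hab hK (Real.exp_pos _) huv h2 he,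
    shape_mem_arc_Q4_E ha hb hab hK (Real.exp_pos _) huv he hl'⟩

include ha hb hab in
/-- The right part of the critical curve leaves the triangle at its end point. -/
lemma one_add_lt_of_logLevel_lt {u v : ℝ} (hu : 0 < u) (huv : u < v) (he : ellipse a b u v = 0)
    (h : logLevel a b u v < endLevel a b) : 1 + u < v := by
  have h1 := lt_endRoot' ha hb hab
  have hu5 : 0 < endRoot a b - b := by linarith
  have h2 := lt_of_logLevel_lt ha hb hab hu5 hu (by linarith) huv.le (ellipse_end ha hb hab) he h
  have h3 := (lt_iff_lt_of_ellipse ha hb hu5 hu (by linarith) (hu.trans huv)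
    (ellipse_end ha hb hab) he).1 h2
  linarith

include hK in
lemma onLevel_of_level {z : ℝ → Config} {l l₀ : ℝ} (hab : a + b = 1)
    (hz : IsMotion (scaledStrength K a b) z) (hzl : ∀ t, level a b (z t) = l) {l₁ : ℝ}
    (h₀ : l₀ < l) (h₁ : l < l₁) :
    OnLevel (scaledStrength K a b) z (Ioo (Real.exp (K * l₀)) (Real.exp (K * l₁))) := by
  refine ⟨Real.exp (K * l), ⟨?_, ?_⟩, fun t => by rw [invI_tri hab (hz t).1, hzl]⟩
  · exact Real.exp_lt_exp.2 (mul_lt_mul_of_pos_left h₀ hK)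
  · exact Real.exp_lt_exp.2 (mul_lt_mul_of_pos_left h₁ hK)

include hK in
lemma onLevel_of_level_neg {z : ℝ → Config} {l l₀ : ℝ} (hab : a + b = 1)
    (hz : IsMotion (scaledStrength K a b) z) (hzl : ∀ t, level a b (z t) = l)
    (h₀ : l₀ < l) (h₁ : l < 0) :
    OnLevel (scaledStrength K a b) z (Ioo (Real.exp (K * l₀)) 1) := by
  have := onLevel_of_level hK hab hz hzl h₀ h₁
  rwa [mul_zero, Real.exp_zero] at this

/-- The data of a motion on the level curve `l` with the angular impulse `M`. -/
structure LevelMotion (K a b l M : ℝ) (z : ℝ → Config) : Prop where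
  motion : IsMotion (scaledStrength K a b) z
  level_eq : ∀ t, level a b (z t) = l
  moment_eq : ∀ t, moment a b (z t) = M

lemma levelMotion_of_isMotion {z : ℝ → Config} (hz : IsMotion (scaledStrength K a b) z) :
    LevelMotion K a b (level a b (z 0)) (moment a b (z 0)) z where
  motion := hz
  level_eq t := is_const_of_deriv_eq_zero (f := fun s => level a b (z s))
    (fun s => (hasDerivAt_level (hz s)).differentiableAt)
    (fun s => (hasDerivAt_level (hz s)).deriv) t 0
  moment_eq t := is_const_of_deriv_eq_zero (f := fun s => moment a b (z s))
    (fun s => (hasDerivAt_moment (hz s)).differentiableAt)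
    (fun s => (hasDerivAt_moment (hz s)).deriv) t 0

/-! ### Motions of fixed level and impulse, type by type -/

namespace LevelMotion

variable {l M : ℝ} {z : ℝ → Config} (h : LevelMotion K a b l M z)

include h

lemma continuous_logRatio : Continuous fun t => logRatio (z t) :=
  continuous_iff_continuousAt.2 fun t => (hasDerivAt_logRatio (h.motion t)).continuousAt

lemma continuous_signedArea : Continuous fun t => signedArea (z t) :=
  continuous_iff_continuousAt.2 fun t => (hasDerivAt_signedArea (h.motion t)).continuousAt

include hab in
lemma tri_eq_levelPoint (t : ℝ) : tri (z t) = levelPoint a b l (logRatio (z t)) := by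
  rw [tri_eq hab (h.motion t).1, h.level_eq, levelPoint]

include hab in
lemma tendsto_tri {F : Filter ℝ} {s : ℝ} (hs : Tendsto (fun t => logRatio (z t)) F (𝓝 s)) :
    Tendsto (fun t => tri (z t)) F (𝓝 (levelPoint a b l s)) := by
  simp only [h.tri_eq_levelPoint hab]
  exact ((continuous_levelPoint a b l).tendsto s).comp hs

include hab in
lemma moment_eq_mul (t : ℝ) : M = side (z t) 2 ^ 2 * levelForm a b l (logRatio (z t)) := by
  rw [← h.moment_eq t, ThreeVortex.moment_eq (h.motion t).1, levelForm, ← h.level_eq t,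
    ratio_zero_eq hab (h.motion t).1, ratio_one_eq hab (h.motion t).1]

include hab in
lemma levelForm_pos (hM : 0 < M) (t : ℝ) : 0 < levelForm a b l (logRatio (z t)) := by
  rw [h.moment_eq_mul hab t] at hM
  exact (mul_pos_iff_of_pos_left (pow_pos (side_pos (h.motion t).1 2) 2)).1 hM

include hab in
lemma levelForm_neg (hM : M < 0) (t : ℝ) : levelForm a b l (logRatio (z t)) < 0 := by
  rw [h.moment_eq_mul hab t] at hM
  exact (pos_iff_neg_of_mul_neg hM).1 (pow_pos (side_pos (h.motion t).1 2) 2)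

include ha hb hK in
lemma formY_pos (hM : 0 < M) (t : ℝ) : 0 < formY (scaledStrength K a b) (tri (z t)) :=
  (formY_tri_pos ha hb hK (h.motion t).1).2 (by rwa [h.moment_eq])

include ha hb hK in
lemma formY_neg (hM : M < 0) (t : ℝ) : formY (scaledStrength K a b) (tri (z t)) < 0 :=
  (formY_tri_neg ha hb hK (h.motion t).1).2 (by rwa [h.moment_eq])

include ha hb hab in
/-- The collinear configurations beyond the end point lie on one of two edges. -/
lemma edge (hl : endLevel a b < l) {t : ℝ} (ht : signedArea (z t) = 0) :
    Real.exp (l - b * logRatio (z t)) = 1 + Real.exp (l + a * logRatio (z t)) ∨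
    Real.exp (l + a * logRatio (z t)) = 1 + Real.exp (l - b * logRatio (z t)) := by
  have hc := (h.motion t).1
  have h2 := side_pos hc 2
  have hne := add_ne_one ha hb hab (Real.exp_pos (l - b * logRatio (z t)))
    (Real.exp_pos (l + a * logRatio (z t))) (by rwa [logLevel_exp hab])
  rw [← h.level_eq t, ← ratio_zero_eq hab hc, ← ratio_one_eq hab hc] at hne ⊢
  rcases edge_of_signedArea_eq_zero hc ht with e | e | e
  · exact absurd (by rw [← add_div, ← e, div_self h2.ne']) hne
  · left; rw [e]; field_simp; ring
  · right; rw [e]; field_simp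

include hab in
lemma ratio_le (t : ℝ) :
    Real.exp (l - b * logRatio (z t)) ≤ 1 + Real.exp (l + a * logRatio (z t)) := by
  have hc := (h.motion t).1
  have h2 := side_pos hc 2
  rw [← h.level_eq t, ← ratio_zero_eq hab hc, ← ratio_one_eq hab hc, ← div_self h2.ne', ← add_div,
    div_le_div_iff_of_pos_right h2]
  linarith [(side_triangle (z t)).1]

include ha hb hab hK in
-- Later only the explicit area rate and the sign of `κ` above the curve matter, so `κ` and `Φ` are
-- hidden.
lemma planarFlow (hl : endLevel a b < l) (hl0 : l < 0) (hM : M ≠ 0) :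
    ∃ κ Φ : ℝ → ℝ, PlanarFlow κ
      (fun s => areaRate K a b (Real.exp (l - b * s)) (Real.exp (l + a * s))) Φ (levelForm a b l)
      (fun t => logRatio (z t)) (fun t => signedArea (z t)) ∧
      ∀ s, 0 < levelForm a b l s → 0 < κ s := by
  refine ⟨_, _, planarFlow_of_isMotion ha hb hab hK h.motion hl hl0 hM h.level_eq h.moment_eq,
    fun s hs => ?_⟩
  change 0 < ellipse _ _ _ _ at hs
  positivity

include hab in
lemma tri_eq_half_one {t : ℝ}
    (ht : Real.exp (l + a * logRatio (z t)) = 1 + Real.exp (l - b * logRatio (z t))) :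
    tri (z t) 1 = 1 / 2 := by
  have := Real.exp_pos (l - b * logRatio (z t))
  rw [h.tri_eq_levelPoint hab, levelPoint, shape_one, ht]
  field_simp
  ring

include hab in
lemma tri_eq_half_zero {t : ℝ}
    (ht : Real.exp (l - b * logRatio (z t)) = 1 + Real.exp (l + a * logRatio (z t))) :
    tri (z t) 0 = 1 / 2 := by
  have := Real.exp_pos (l + a * logRatio (z t))
  rw [h.tri_eq_levelPoint hab, levelPoint, shape_zero, ht]
  field_simp
  ring

include ha hb hab hK in
-- Below the curve `s` cannot pass 0, where the form is positive. With `s > 0` only the edge `v = 1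
-- + u` is reachable, where the area decreases, and only one critical point can be a limit: there is
-- exactly one crossing.
theorem typeIRight (hl : endLevel a b < l) (hl0 : l < 0) (hM : M < 0)
    (hs : ∃ t, 0 < logRatio (z t)) : TypeIRight (scaledStrength K a b) z := by
  have hneg := h.levelForm_neg hab hM
  have h0 := levelForm_zero_pos (a := a) hab hl0
  have hpos := pos_of_continuous_of_ne_zero h.continuous_logRatio
    (fun t e => by have := hneg t; rw [e] at this; linarith) hs
  obtain ⟨s₀, hs₀, he₀, huniq⟩ := exists_critical_right ha hb hab hl0
  obtain ⟨κ, Φ, hp, -⟩ := h.planarFlow ha hb hab hK hl hl0 hM.ne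
  have hedge : ∀ t, signedArea (z t) = 0 →
      Real.exp (l + a * logRatio (z t)) = 1 + Real.exp (l - b * logRatio (z t)) := fun t ht => by
    rcases h.edge ha hb hab hl ht with e | e
    · have := (exp_lt_exp_iff_pos hab l _).2 (hpos t)
      linarith
    · exact e
  obtain ⟨t₀, hA0, hbef, haft, htop, hbot⟩ := hp.exists_crossing s₀ (fun s hs he => by
      have h1 : 0 ≤ s := hs.elim (fun hs => ge_of_tendsto' hs fun t => (hpos t).le)
        (fun hs => ge_of_tendsto' hs fun t => (hpos t).le)
      refine huniq s (lt_of_le_of_ne h1 fun e => ?_) he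
      rw [← e] at he; linarith) (fun t ht => by
      have e := hedge t ht
      have := hneg t
      rw [levelForm, e] at this
      rw [e, areaRate_edge_one hab (Real.exp_pos _)]
      exact mul_neg_of_pos_of_neg (by positivity) this)
  obtain ⟨hcon, hexp, harc⟩ := levelPoint_right ha hb hab hK hl hs₀ he₀
  refine ⟨?_, fun t => ⟨h.formY_neg ha hb hK hM t,
    (tri_zero_lt_one hab (h.motion t).1).2 (hpos t)⟩, ⟨t₀, fun t ht =>
      orientation_eq_one_iff.2 (hbef t ht), h.tri_eq_half_one hab (hedge t₀ hA0), fun t ht =>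
      orientation_eq_neg_one_iff.2 (haft t ht)⟩, _, harc, ⟨hcon, h.tendsto_tri hab hbot, ?_⟩,
      ⟨hexp, h.tendsto_tri hab htop, ?_⟩⟩
  · rw [I5_eq ha hb hab hK]; exact onLevel_of_level_neg hK hab h.motion h.level_eq hl hl0
  · filter_upwards [eventually_lt_atBot t₀] with t ht
    exact orientation_eq_one_iff.2 (hbef t ht)
  · filter_upwards [eventually_gt_atTop t₀] with t ht
    exact orientation_eq_neg_one_iff.2 (haft t ht)

include ha hb hab hK in
-- Mirror image of the right case. On the edge `u = 1 + v` below the curve the area increases, so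
-- the reflected flow is used.
theorem typeILeft (hl : endLevel a b < l) (hl' : endLevel b a < l) (hl0 : l < 0) (hM : M < 0)
    (hs : ∃ t, logRatio (z t) < 0) : TypeILeft (scaledStrength K a b) z := by
  have hneg := h.levelForm_neg hab hM
  have h0 := levelForm_zero_pos (a := a) hab hl0
  have hpos : ∀ t, logRatio (z t) < 0 := fun t => neg_pos.1 <|
    pos_of_continuous_of_ne_zero (f := fun t => -logRatio (z t)) h.continuous_logRatio.neg
    (fun t e => by have := hneg t; rw [neg_eq_zero.1 e] at this; linarith)
    (hs.imp fun t ht => neg_pos.2 ht) t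
  obtain ⟨s₀, hs₀, he₀, huniq⟩ := exists_critical_left ha hb hab hl0
  obtain ⟨κ, Φ, hp, -⟩ := h.planarFlow ha hb hab hK hl hl0 hM.ne
  have hedge : ∀ t, signedArea (z t) = 0 →
      Real.exp (l - b * logRatio (z t)) = 1 + Real.exp (l + a * logRatio (z t)) := fun t ht => by
    rcases h.edge ha hb hab hl ht with e | e
    · exact e
    · have := (exp_lt_exp_iff_neg hab l _).2 (hpos t)
      linarith
  obtain ⟨t₀, hA0, hbef, haft, htop, hbot⟩ := hp.neg.exists_crossing s₀ (fun s hs he => by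
      have h1 : s ≤ 0 := hs.elim (fun hs => le_of_tendsto' hs fun t => (hpos t).le)
        (fun hs => le_of_tendsto' hs fun t => (hpos t).le)
      refine huniq s (lt_of_le_of_ne h1 fun e => ?_) he
      rw [e] at he; linarith) (fun t ht => by
      have e := hedge t (neg_eq_zero.1 ht)
      have := hneg t
      rw [levelForm, e] at this
      rw [e, areaRate_edge_zero hab (Real.exp_pos _), neg_neg]
      exact mul_neg_of_pos_of_neg (by positivity) this)
  simp only [neg_pos, neg_lt_zero, neg_eq_zero] at hA0 hbef haft
  obtain ⟨hcon, hexp, harc⟩ := levelPoint_left ha hb hab hK hl' hs₀ he₀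
  refine ⟨?_, fun t => ⟨h.formY_neg ha hb hK hM t,
    (tri_one_lt_zero hab (h.motion t).1).2 (hpos t)⟩, ⟨t₀, fun t ht =>
      orientation_eq_neg_one_iff.2 (hbef t ht), h.tri_eq_half_zero hab (hedge t₀ hA0), fun t ht =>
      orientation_eq_one_iff.2 (haft t ht)⟩, _, harc, ⟨hcon, h.tendsto_tri hab hbot, ?_⟩,
      ⟨hexp, h.tendsto_tri hab htop, ?_⟩⟩
  · rw [I4_eq ha hb hab hK]; exact onLevel_of_level_neg hK hab h.motion h.level_eq hl' hl0
  · filter_upwards [eventually_lt_atBot t₀] with t ht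
    exact orientation_eq_neg_one_iff.2 (hbef t ht)
  · filter_upwards [eventually_gt_atTop t₀] with t ht
    exact orientation_eq_one_iff.2 (haft t ht)

include ha hb hab in
-- At such levels both reachable edges meet the level curve below the critical curve, whereas `M >
-- 0` keeps the motion above it.
lemma signedArea_ne_zero (hl : endLevel a b < l) (hl' : endLevel b a < l) (hM : 0 < M) (t : ℝ) :
    signedArea (z t) ≠ 0 := fun ht => by
  have hpos := h.levelForm_pos hab hM t
  have hlev := logLevel_exp hab l (logRatio (z t))
  rcases h.edge ha hb hab hl ht with e | e
  · have := ellipse_neg_of_edge hb ha (by linarith) (Real.exp_pos (l + a * logRatio (z t))) e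
      (by rwa [logLevel_swap, hlev])
    rw [ellipse_swap] at this
    exact absurd hpos (not_lt.2 this.le)
  · have := ellipse_neg_of_edge ha hb hab (Real.exp_pos (l - b * logRatio (z t))) e
      (by rwa [hlev])
    exact absurd hpos (not_lt.2 this.le)

variable {u₀ v₀ : ℝ} (hu₀ : 0 < u₀) (huv₀ : u₀ < v₀) (he₀ : ellipse a b u₀ v₀ = 0)
  (hl₀ : logLevel a b u₀ v₀ = endLevel b a)

omit h in
include ha hb hab hK hu₀ huv₀ he₀ hl₀ in
lemma levelPoint_mem_arc_E_S4 {s : ℝ} (hl : endLevel a b < l) (hl' : endLevel b a < l)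
    (hl0 : l < 0) (hs : 0 < s) (he : levelForm a b l s = 0) :
    levelPoint a b l s ∈ arc (scaledStrength K a b) pointE (shape u₀ v₀) := by
  rw [pointE_eq_shape]
  have hlev := logLevel_exp hab l s
  exact shape_mem_arc_right ha hb hab hK (Real.exp_pos _) ((exp_lt_exp_iff_pos hab l s).2 hs) he
    (by rwa [hlev]) one_pos le_rfl (ellipse_one_one hab) hu₀ huv₀.le he₀
    (by rwa [hlev, logLevel_one_one]) (by rwa [hlev, hl₀])

include ha hb hab hK hu₀ huv₀ he₀ hl₀ in
-- Never collinear, the motion keeps its orientation and `s` strictly decreases; its limits are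
-- distinct critical points, hence on opposite sides of 0.
theorem typeIIPos (hl : endLevel a b < l) (hl' : endLevel b a < l) (hl0 : l < 0) (hM : 0 < M)
    (hA : ∃ t, 0 < signedArea (z t)) : TypeIIPos (scaledStrength K a b) (shape u₀ v₀) z := by
  have hne := h.signedArea_ne_zero ha hb hab hl hl' hM
  have hpos := pos_of_continuous_of_ne_zero h.continuous_signedArea hne hA
  obtain ⟨κ, Φ, hp, hκ⟩ := h.planarFlow ha hb hab hK hl hl0 hM.ne'
  have hanti := hp.strictAnti fun t => mul_pos (hκ _ (h.levelForm_pos hab hM t)) (hpos t)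
  obtain ⟨s₁, hs₁, he₁⟩ := hp.exists_tendsto_atTop (T := 0) fun t _ => hne t
  obtain ⟨s₂, hs₂, he₂⟩ := hp.exists_tendsto_atBot (T := 0) fun t _ => hne t
  have hlt : s₁ < s₂ := (hanti.antitone.le_of_tendsto hs₁ 1).trans_lt
    ((hanti zero_lt_one).trans_le (hanti.antitone.ge_of_tendsto hs₂ 0))
  obtain ⟨h1, h2⟩ := neg_pos_of_critical ha hb hab hl0 hlt he₁ he₂
  obtain ⟨hcon, -, -⟩ := levelPoint_right ha hb hab hK hl h2 he₂
  obtain ⟨-, hexp, harc⟩ := levelPoint_left ha hb hab hK hl' h1 he₁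
  have hor : ∀ t, orientation (z t) = 1 := fun t => orientation_eq_one_iff.2 (hpos t)
  refine ⟨?_, h.formY_pos ha hb hK hM, hor,
    ⟨_, levelPoint_mem_arc_E_S4 ha hb hab hK hu₀ huv₀ he₀ hl₀ hl hl' hl0 h2 he₂,
      hcon, h.tendsto_tri hab hs₂, .of_forall hor⟩, _, harc, hexp, h.tendsto_tri hab hs₁,
      .of_forall hor⟩
  rw [I4_eq ha hb hab hK]; exact onLevel_of_level_neg hK hab h.motion h.level_eq hl' hl0

include ha hb hab hK hu₀ huv₀ he₀ hl₀ in
-- With negative area `s` increases, so the two limits exchange their roles.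
theorem typeIINeg (hl : endLevel a b < l) (hl' : endLevel b a < l) (hl0 : l < 0) (hM : 0 < M)
    (hA : ∃ t, signedArea (z t) < 0) : TypeIINeg (scaledStrength K a b) (shape u₀ v₀) z := by
  have hne := h.signedArea_ne_zero ha hb hab hl hl' hM
  have hneg : ∀ t, signedArea (z t) < 0 := fun t => neg_pos.1 <|
    pos_of_continuous_of_ne_zero (f := fun t => -signedArea (z t)) h.continuous_signedArea.neg
    (fun t => neg_ne_zero.2 (hne t)) (hA.imp fun t ht => neg_pos.2 ht) t
  obtain ⟨κ, Φ, hp, hκ⟩ := h.planarFlow ha hb hab hK hl hl0 hM.ne'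
  have hmono := hp.strictMono fun t =>
    mul_neg_of_pos_of_neg (hκ _ (h.levelForm_pos hab hM t)) (hneg t)
  obtain ⟨s₁, hs₁, he₁⟩ := hp.exists_tendsto_atTop (T := 0) fun t _ => hne t
  obtain ⟨s₂, hs₂, he₂⟩ := hp.exists_tendsto_atBot (T := 0) fun t _ => hne t
  have hlt : s₂ < s₁ := (hmono.monotone.le_of_tendsto hs₂ 0).trans_lt
    ((hmono zero_lt_one).trans_le (hmono.monotone.ge_of_tendsto hs₁ 1))
  obtain ⟨h2, h1⟩ := neg_pos_of_critical ha hb hab hl0 hlt he₂ he₁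
  obtain ⟨-, hexp, -⟩ := levelPoint_right ha hb hab hK hl h1 he₁
  obtain ⟨hcon, -, harc⟩ := levelPoint_left ha hb hab hK hl' h2 he₂
  have hor : ∀ t, orientation (z t) = -1 := fun t => orientation_eq_neg_one_iff.2 (hneg t)
  refine ⟨?_, h.formY_pos ha hb hK hM, hor,
    ⟨_, harc, hcon, h.tendsto_tri hab hs₂, .of_forall hor⟩,
    _, levelPoint_mem_arc_E_S4 ha hb hab hK hu₀ huv₀ he₀ hl₀ hl hl' hl0 h1 he₁,
      hexp, h.tendsto_tri hab hs₁, .of_forall hor⟩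
  rw [I4_eq ha hb hab hK]; exact onLevel_of_level_neg hK hab h.motion h.level_eq hl' hl0

include ha hb hab hK hu₀ huv₀ he₀ hl₀ in
-- The edge `v = 1 + u` lies below the curve at this level, so only `u = 1 + v` can be crossed, with
-- decreasing area. The left critical point is outside the triangle, which leaves one possible
-- limit.
theorem typeIII (hl : endLevel a b < l) (hl' : l < endLevel b a) (hM : 0 < M) :
    TypeIII (scaledStrength K a b) (shape u₀ v₀) z := by
  have hl0 : l < 0 := hl'.trans (endLevel_neg hb ha (by linarith))
  have hpos := h.levelForm_pos hab hM
  have h0 := levelForm_zero_pos (a := a) hab hl0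
  obtain ⟨s₀, hs₀, he, huniq⟩ := exists_critical_right ha hb hab hl0
  obtain ⟨κ, Φ, hp, -⟩ := h.planarFlow ha hb hab hK hl hl0 hM.ne'
  have hedge : ∀ t, signedArea (z t) = 0 →
      Real.exp (l - b * logRatio (z t)) = 1 + Real.exp (l + a * logRatio (z t)) := fun t ht => by
    rcases h.edge ha hb hab hl ht with e | e
    · exact e
    · have := ellipse_neg_of_edge ha hb hab (Real.exp_pos (l - b * logRatio (z t))) e
        (by rwa [logLevel_exp hab])
      exact absurd (hpos t) (not_lt.2 this.le)
  have hlim : ∀ s, (Tendsto (fun t => logRatio (z t)) atTop (𝓝 s) ∨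
      Tendsto (fun t => logRatio (z t)) atBot (𝓝 s)) → levelForm a b l s = 0 → s = s₀ := by
    intro s hs he
    refine huniq s ?_ he
    by_contra! hle
    have hs0 : s < 0 := lt_of_le_of_ne hle fun e => by rw [e] at he; linarith
    -- The triangle inequality passes to the limit, but the left critical point violates it at a
    -- level below that of Q₄.
    have hle : Real.exp (l - b * s) ≤ 1 + Real.exp (l + a * s) := by
      have c1 : Continuous fun s => Real.exp (l - b * s) := by fun_prop
      have c2 : Continuous fun s => 1 + Real.exp (l + a * s) := by fun_prop
      rcases hs with hs | hs
      · exact le_of_tendsto_of_tendsto' ((c1.tendsto s).comp hs) ((c2.tendsto s).comp hs)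
          (h.ratio_le hab)
      · exact le_of_tendsto_of_tendsto' ((c1.tendsto s).comp hs) ((c2.tendsto s).comp hs)
          (h.ratio_le hab)
    have he' := he
    rw [levelForm, ellipse_swap] at he'
    have := one_add_lt_of_logLevel_lt hb ha (by linarith) (Real.exp_pos _)
      ((exp_lt_exp_iff_neg hab l s).2 hs0) he' (by rwa [logLevel_swap, logLevel_exp hab])
    linarith
  obtain ⟨t₀, hA0, hbef, haft, htop, hbot⟩ := hp.exists_crossing s₀ hlim (fun t ht => by
      have e := hedge t ht
      have := hpos t
      rw [levelForm, e] at this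
      rw [e, areaRate_edge_zero hab (Real.exp_pos _)]
      exact neg_neg_of_pos (mul_pos (by positivity) this))
  obtain ⟨hcon, hexp, -⟩ := levelPoint_right ha hb hab hK hl hs₀ he
  have hlev := logLevel_exp hab l s₀
  have h1 := lt_endRoot' ha hb hab
  have harc : levelPoint a b l s₀ ∈ arc (scaledStrength K a b) (shape u₀ v₀)
      (pointQ5 (scaledStrength K a b)) := by
    rw [pointQ5_eq_shape ha hb hab hK]
    exact shape_mem_arc_right ha hb hab hK (Real.exp_pos _)
      ((exp_lt_exp_iff_pos hab l s₀).2 hs₀) he (by rwa [hlev]) hu₀ huv₀.le he₀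
      (by linarith) (by linarith) (ellipse_end ha hb hab) (by rwa [hlev, hl₀]) (by rwa [hlev])
  refine ⟨?_, h.formY_pos ha hb hK hM, ⟨t₀, fun t ht =>
      orientation_eq_one_iff.2 (hbef t ht), h.tri_eq_half_zero hab (hedge t₀ hA0), fun t ht =>
      orientation_eq_neg_one_iff.2 (haft t ht)⟩, _, harc, ⟨hcon, h.tendsto_tri hab hbot, ?_⟩,
      ⟨hexp, h.tendsto_tri hab htop, ?_⟩⟩
  · rw [I5_eq ha hb hab hK, I4_eq ha hb hab hK]
    exact onLevel_of_level hK hab h.motion h.level_eq hl hl'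
  · filter_upwards [eventually_lt_atBot t₀] with t ht
    exact orientation_eq_one_iff.2 (hbef t ht)
  · filter_upwards [eventually_gt_atTop t₀] with t ht
    exact orientation_eq_neg_one_iff.2 (haft t ht)

end LevelMotion

end

end ThreeVortex

namespace ThreeVortex

/-! ### The classification -/

section

variable {a b : ℝ} (ha : 0 < a) (hb : 0 < b) (hab : a + b = 1) {K : ℝ} (hK : 0 < K)

lemma continuousAt_invI {k x : Fin 3 → ℝ} (h : ∀ j, 0 < x j) : ContinuousAt (invI k) x := by
  unfold invI
  have h0 : x 0 / x 2 ≠ 0 := (div_pos (h 0) (h 2)).ne'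
  have h1 : x 1 / x 2 ≠ 0 := (div_pos (h 1) (h 2)).ne'
  have c : ∀ j, ContinuousAt (fun y : Fin 3 → ℝ => y j) x := fun j =>
    (continuous_apply j).continuousAt
  exact (((c 0).div (c 2) (h 2).ne').rpow_const (.inl h0)).mul
    (((c 1).div (c 2) (h 2).ne').rpow_const (.inl h1))

include hab hK in
/-- The limit of a motion lies on the same level curve. -/
lemma LevelMotion.level_of_tendsto {l M : ℝ} {z : ℝ → Config} (h : LevelMotion K a b l M z)
    {F : Filter ℝ} [F.NeBot] {u v : ℝ} (hu : 0 < u) (hv : 0 < v)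
    (ht : Tendsto (fun t => tri (z t)) F (𝓝 (shape u v))) : logLevel a b u v = l := by
  have hpos : ∀ j, 0 < shape u v j := fun j => by fin_cases j <;> simp [shape] <;> positivity
  have h1 := (continuousAt_invI (k := scaledStrength K a b) hpos).tendsto.comp ht
  have h2 : (invI (scaledStrength K a b) ∘ fun t => tri (z t)) = fun _ => Real.exp (K * l) := by
    funext t
    rw [Function.comp_apply, invI_tri hab (h.motion t).1, h.level_eq]
  rw [h2, invI_shape hu hv] at h1
  have h3 := tendsto_nhds_unique h1 tendsto_const_nhds
  exact mul_left_cancel₀ hK.ne' (Real.exp_injective h3)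

include ha hb hab hK in
/-- A motion that departs from a contracting point belongs to one of the types. -/
lemma LevelMotion.classification (hle : a ≤ b) {l M : ℝ} {z : ℝ → Config}
    (h : LevelMotion K a b l M z) (hM : M ≠ 0) (hsep : ¬ (0 < M ∧ l = endLevel b a))
    {u₀ v₀ : ℝ} (hu₀ : 0 < u₀) (huv₀ : u₀ < v₀) (he₀ : ellipse a b u₀ v₀ = 0)
    (hl₀ : logLevel a b u₀ v₀ = endLevel b a)
    {q : Fin 3 → ℝ} {γ : SignType} (hq : DepartsFrom (scaledStrength K a b) z q γ) :
    TypeIRight (scaledStrength K a b) z ∨ TypeILeft (scaledStrength K a b) z ∨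
    TypeIIPos (scaledStrength K a b) (shape u₀ v₀) z ∨
    TypeIINeg (scaledStrength K a b) (shape u₀ v₀) z ∨
    TypeIII (scaledStrength K a b) (shape u₀ v₀) z := by
  obtain ⟨hcon, hlim, hor⟩ := hq
  obtain ⟨u, v, hu, hv, rfl, he, hside⟩ := of_isContracting ha hb hab hK hcon
  -- The departure point fixes the level, and its being strictly inside the triangle bounds that
  -- level from below.
  have hlev := h.level_of_tendsto hab hK hu hv hlim
  have t0 : Tendsto (fun t => tri (z t) 0) atBot (𝓝 (shape u v 0)) :=
    ((continuous_apply 0).tendsto _).comp hlim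
  have t1 : Tendsto (fun t => tri (z t) 1) atBot (𝓝 (shape u v 1)) :=
    ((continuous_apply 1).tendsto _).comp hlim
  have hee := endLevel_le_swap ha hb hab hle
  rcases hside with ⟨rfl, huv, hin⟩ | ⟨rfl, huv, hin⟩
  · have hl : endLevel a b < l := by rw [← hlev]; exact (lt_one_add_iff ha hb hab hu huv he).1 hin
    have hl0 : l < 0 := by rw [← hlev]; exact logLevel_neg_of_ellipse ha hb hab hu huv he
    rcases lt_or_gt_of_ne hM with hM | hM
    · left
      obtain ⟨t, ht⟩ := (t0.eventually_lt t1 ((shape_lt_iff hu hv).2 huv)).exists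
      exact h.typeIRight ha hb hab hK hl hl0 hM ⟨t, (tri_zero_lt_one hab (h.motion t).1).1 ht⟩
    -- The level of Q₄ separates type III from type II; equality is the separatrix.
    · rcases lt_trichotomy l (endLevel b a) with hl' | hl' | hl'
      · exact .inr (.inr (.inr (.inr (h.typeIII ha hb hab hK hu₀ huv₀ he₀ hl₀ hl hl' hM))))
      · exact absurd ⟨hM, hl'⟩ hsep
      · obtain ⟨t, ht⟩ := hor.exists
        exact .inr (.inr (.inl (h.typeIIPos ha hb hab hK hu₀ huv₀ he₀ hl₀ hl hl' hl0 hM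
          ⟨t, orientation_eq_one_iff.1 ht⟩)))
  · have he' := he
    rw [ellipse_swap] at he'
    have hba : b + a = 1 := by linarith
    have hl' : endLevel b a < l := by
      rw [← hlev, logLevel_swap]; exact (lt_one_add_iff hb ha hba hv huv he').1 hin
    have hl0 : l < 0 := by
      rw [← hlev, logLevel_swap]; exact logLevel_neg_of_ellipse hb ha hba hv huv he'
    rcases lt_or_gt_of_ne hM with hM | hM
    · obtain ⟨t, ht⟩ := (t1.eventually_lt t0 ((shape_lt_iff' hu hv).2 huv)).exists
      exact .inr (.inl (h.typeILeft ha hb hab hK (by linarith) hl' hl0 hM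
        ⟨t, (tri_one_lt_zero hab (h.motion t).1).1 ht⟩))
    · obtain ⟨t, ht⟩ := hor.exists
      exact .inr (.inr (.inr (.inl (h.typeIINeg ha hb hab hK hu₀ huv₀ he₀ hl₀ (by linarith) hl'
        hl0 hM ⟨t, orientation_eq_neg_one_iff.1 ht⟩))))

include ha hb hab hK in
/-- The points on the right part of the critical curve at the level of `Q₄`. -/
lemma isS4_iff (hle : a ≤ b) {u₀ v₀ : ℝ} (hu₀ : 0 < u₀) (huv₀ : u₀ < v₀)
    (he₀ : ellipse a b u₀ v₀ = 0) (hl₀ : logLevel a b u₀ v₀ = endLevel b a) (s : Fin 3 → ℝ) :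
    IsS4 (scaledStrength K a b) s ↔ s = shape u₀ v₀ := by
  have hv₀ := hu₀.trans huv₀
  constructor
  · rintro ⟨hs, hlt, hI⟩
    have hsum := hs.1.1
    have hnn := fun j => (hs.1.2 j).1
    have hne : ∀ j, s j ≠ 0 → 0 < s j := fun j h => lt_of_le_of_ne (hnn j) h.symm
    -- With `x / 0 = 0` and `0 ^ r = 0` for `r ≠ 0`, a vanishing first or third coordinate would
    -- make the invariant zero.
    have hIp : invI (scaledStrength K a b) s ≠ 0 := by
      rw [hI, I4_eq ha hb hab hK]; exact (Real.exp_pos _).ne'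
    have hk1 : scaledStrength K a b 1 ≠ 0 := (mul_pos ha hK).ne'
    have hk0 : scaledStrength K a b 0 ≠ 0 := (mul_pos hb hK).ne'
    have h2 : 0 < s 2 := hne 2 fun e => hIp (by simp [invI, e, hk1])
    have h0 : 0 < s 0 := hne 0 fun e => hIp (by simp [invI, e, hk1])
    have h1 : 0 < s 1 := h0.trans hlt
    have hu := div_pos h0 h2
    have hv := div_pos h1 h2
    rw [eq_shape_of_sum h2 hsum] at hs hlt hI ⊢
    have huv := (shape_lt_iff hu hv).1 hlt
    have he := ((shape_mem_criticalCurve ha hb hab hK hu hv).1 hs).2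
    rw [invI_shape hu hv, I4_eq ha hb hab hK] at hI
    have hl := mul_left_cancel₀ hK.ne' (Real.exp_injective hI)
    obtain ⟨e1, e2⟩ := eq_of_logLevel_eq ha hb hab hu₀ hu huv₀.le huv.le he₀ he
      (hl.trans hl₀.symm)
    rw [← e1, ← e2]
  · rintro rfl
    refine ⟨(shape_mem_criticalCurve ha hb hab hK hu₀ hv₀).2 ⟨⟨by linarith, ?_⟩, he₀⟩,
      (shape_lt_iff hu₀ hv₀).2 huv₀, by rw [invI_shape hu₀ hv₀, I4_eq ha hb hab hK, hl₀]⟩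
    exact le_one_add_of_endLevel_le ha hb hab hu₀ huv₀ he₀
      (by rw [hl₀]; exact endLevel_le_swap ha hb hab hle)

end

lemma strength_eq_scaledStrength {k₁ k₂ : ℝ} (h : 0 < k₁ + k₂) :
    strength k₁ k₂ = scaledStrength (k₁ + k₂) (k₂ / (k₁ + k₂)) (k₁ / (k₁ + k₂)) := by
  funext i
  fin_cases i <;> simp [strength, scaledStrength] <;> field_simp

end ThreeVortex

theorem mainTheorem5 (k₁ k₂ : ℝ) (hk₂ : 0 < k₂) (hk : k₂ ≤ k₁) (k : Fin 3 → ℝ)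
    (hkk : k = ThreeVortex.strength k₁ k₂) :
    ∃ s : Fin 3 → ℝ,
      -- the point `S₄`
      (ThreeVortex.IsS4 k s ∧ ∀ s', ThreeVortex.IsS4 k s' → s' = s) ∧
      -- every configuration in the open strip and off the critical curve moves for all times
      (∀ c : ThreeVortex.Config, Function.Injective c →
        ThreeVortex.invI k (ThreeVortex.tri c) ∈ Set.Ioo (ThreeVortex.I5 k) 1 →
        ThreeVortex.formY k (ThreeVortex.tri c) ≠ 0 →
        ∃ z : ℝ → ThreeVortex.Config, ThreeVortex.IsMotion k z ∧ z 0 = c) ∧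
      ∀ z : ℝ → ThreeVortex.Config, ThreeVortex.IsMotion k z →
        -- type I
        (ThreeVortex.orientation (z 0) = 1 → ThreeVortex.formY k (ThreeVortex.tri (z 0)) < 0 →
          ThreeVortex.tri (z 0) 0 < ThreeVortex.tri (z 0) 1 →
          ThreeVortex.invI k (ThreeVortex.tri (z 0)) ∈ Set.Ioo (ThreeVortex.I5 k) 1 →
          ThreeVortex.TypeIRight k z) ∧
        (ThreeVortex.orientation (z 0) = -1 → ThreeVortex.formY k (ThreeVortex.tri (z 0)) < 0 →
          ThreeVortex.tri (z 0) 1 < ThreeVortex.tri (z 0) 0 →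
          ThreeVortex.invI k (ThreeVortex.tri (z 0)) ∈ Set.Ioo (ThreeVortex.I4 k) 1 →
          ThreeVortex.TypeILeft k z) ∧
        -- type II
        (ThreeVortex.orientation (z 0) = 1 → 0 < ThreeVortex.formY k (ThreeVortex.tri (z 0)) →
          ThreeVortex.invI k (ThreeVortex.tri (z 0)) ∈ Set.Ioo (ThreeVortex.I4 k) 1 →
          ThreeVortex.TypeIIPos k s z) ∧
        (ThreeVortex.orientation (z 0) = -1 → 0 < ThreeVortex.formY k (ThreeVortex.tri (z 0)) →
          ThreeVortex.invI k (ThreeVortex.tri (z 0)) ∈ Set.Ioo (ThreeVortex.I4 k) 1 →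
          ThreeVortex.TypeIINeg k s z) ∧
        -- type III
        (ThreeVortex.orientation (z 0) = 1 → 0 < ThreeVortex.formY k (ThreeVortex.tri (z 0)) →
          ThreeVortex.invI k (ThreeVortex.tri (z 0)) ∈
            Set.Ioo (ThreeVortex.I5 k) (ThreeVortex.I4 k) →
          ThreeVortex.TypeIII k s z) ∧
        -- every trajectory off the critical curve that departs from a contracting branch is of
        -- one of these types, unless it lies on the separatrix above the curve
        ((∃ q γ, ThreeVortex.DepartsFrom k z q γ) →
          ThreeVortex.formY k (ThreeVortex.tri (z 0)) ≠ 0 →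
          ¬ (0 < ThreeVortex.formY k (ThreeVortex.tri (z 0)) ∧
            ThreeVortex.invI k (ThreeVortex.tri (z 0)) = ThreeVortex.I4 k) →
          ThreeVortex.TypeIRight k z ∨ ThreeVortex.TypeILeft k z ∨
            ThreeVortex.TypeIIPos k s z ∨ ThreeVortex.TypeIINeg k s z ∨
            ThreeVortex.TypeIII k s z) := by
  have hk₁ : 0 < k₁ := hk₂.trans_le hk
  have hK : 0 < k₁ + k₂ := by positivity
  rw [ThreeVortex.strength_eq_scaledStrength hK] at hkk
  have hle : k₂ / (k₁ + k₂) ≤ k₁ / (k₁ + k₂) := div_le_div_of_nonneg_right hk hK.le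
  have ha : 0 < k₂ / (k₁ + k₂) := by positivity
  have hb : 0 < k₁ / (k₁ + k₂) := by positivity
  have hab : k₂ / (k₁ + k₂) + k₁ / (k₁ + k₂) = 1 := by field_simp; ring
  -- From here on only positivity, `a + b = 1` and `a ≤ b` are retained.
  generalize k₁ + k₂ = K at *
  generalize k₂ / K = a at *
  generalize k₁ / K = b at *
  subst hkk
  have hba : b + a = 1 := by linarith
  have hl4 := ThreeVortex.endLevel_neg hb ha hba
  have hee := ThreeVortex.endLevel_le_swap ha hb hab hle
  -- S₄ is the right critical point on the level curve of Q₄.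
  obtain ⟨s₀, hs₀, he₀, -⟩ := ThreeVortex.exists_critical_right ha hb hab hl4
  have huv₀ := (ThreeVortex.exp_lt_exp_iff_pos hab (ThreeVortex.endLevel b a) s₀).2 hs₀
  have hl₀ := ThreeVortex.logLevel_exp hab (ThreeVortex.endLevel b a) s₀
  have hu₀ := Real.exp_pos (ThreeVortex.endLevel b a - b * s₀)
  change ThreeVortex.ellipse a b _ _ = 0 at he₀
  have hS4 := ThreeVortex.isS4_iff ha hb hab hK hle hu₀ huv₀ he₀ hl₀
  -- This gives every interval of the invariant exponential end points, so that `hlevel` treats them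
  -- uniformly.
  have hone : (1 : ℝ) = Real.exp (K * 0) := by simp
  have hlevel : ∀ c : ThreeVortex.Config, Function.Injective c → ∀ l₁ l₂,
      (ThreeVortex.invI (ThreeVortex.scaledStrength K a b) (ThreeVortex.tri c) ∈
        Set.Ioo (Real.exp (K * l₁)) (Real.exp (K * l₂)) →
      l₁ < ThreeVortex.level a b c ∧ ThreeVortex.level a b c < l₂) := by
    intro c hc l₁ l₂ h
    rw [ThreeVortex.invI_tri hab hc] at h
    exact ⟨lt_of_mul_lt_mul_left (Real.exp_lt_exp.1 h.1) hK.le,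
      lt_of_mul_lt_mul_left (Real.exp_lt_exp.1 h.2) hK.le⟩
  rw [ThreeVortex.I5_eq ha hb hab hK, ThreeVortex.I4_eq ha hb hab hK, hone]
  refine ⟨_, ⟨(hS4 _).2 rfl, fun s' => (hS4 s').1⟩, ?_, ?_⟩
  · intro c hc hI hY
    refine ThreeVortex.exists_isMotion ha hb hab hc (hlevel c hc _ _ hI).2 fun hM => hY ?_
    rw [ThreeVortex.formY_tri hc, hM, mul_zero]
  · intro z hz
    have h := ThreeVortex.levelMotion_of_isMotion hz
    have hc := (hz 0).1
    refine ⟨fun _ hY hx hI => ?_, fun _ hY hx hI => ?_, fun hor hY hI => ?_, fun hor hY hI => ?_,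
      fun _ hY hI => ?_, ?_⟩
    · obtain ⟨h1, h2⟩ := hlevel _ hc _ _ hI
      exact h.typeIRight ha hb hab hK h1 h2 ((ThreeVortex.formY_tri_neg ha hb hK hc).1 hY)
        ⟨0, (ThreeVortex.tri_zero_lt_one hab hc).1 hx⟩
    · obtain ⟨h1, h2⟩ := hlevel _ hc _ _ hI
      exact h.typeILeft ha hb hab hK (by linarith) h1 h2
        ((ThreeVortex.formY_tri_neg ha hb hK hc).1 hY)
        ⟨0, (ThreeVortex.tri_one_lt_zero hab hc).1 hx⟩
    · obtain ⟨h1, h2⟩ := hlevel _ hc _ _ hI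
      exact h.typeIIPos ha hb hab hK hu₀ huv₀ he₀ hl₀ (by linarith) h1 h2
        ((ThreeVortex.formY_tri_pos ha hb hK hc).1 hY)
        ⟨0, ThreeVortex.orientation_eq_one_iff.1 hor⟩
    · obtain ⟨h1, h2⟩ := hlevel _ hc _ _ hI
      exact h.typeIINeg ha hb hab hK hu₀ huv₀ he₀ hl₀ (by linarith) h1 h2
        ((ThreeVortex.formY_tri_pos ha hb hK hc).1 hY)
        ⟨0, ThreeVortex.orientation_eq_neg_one_iff.1 hor⟩
    · obtain ⟨h1, h2⟩ := hlevel _ hc _ _ hI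
      exact h.typeIII ha hb hab hK hu₀ huv₀ he₀ hl₀ h1 h2
        ((ThreeVortex.formY_tri_pos ha hb hK hc).1 hY)
    · rintro ⟨q, γ, hq⟩ hY hsep
      refine h.classification ha hb hab hK hle (fun hM => hY ?_) (fun ⟨hM, hl⟩ => hsep ⟨?_, ?_⟩)
        hu₀ huv₀ he₀ hl₀ hq
      · rw [ThreeVortex.formY_tri hc, hM, mul_zero]
      · exact (ThreeVortex.formY_tri_pos ha hb hK hc).2 hM
      · rw [ThreeVortex.invI_tri hab hc, hl]
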